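/- For complex $a,q$ with $|q|<1$ and $n\ge 0$ put $(a;q)_n=\prod_{j=0}^{n-1}(1-aq^j)$, $(a;q)_\infty=\prod_{j=0}^{\infty}(1-aq^j)$ and $(a,b,c;q)_\infty=(a;q)_\infty(b;q)_\infty(c;q)_\infty$. Let $|q|<1$; in parts (2) and (3), $q^{1/2}$ denotes any fixed complex number $s$ with $s^2=q$, and $q^{r/2}=s^r$ for integers $r\ge 0$. All the multiple series below converge absolutely. (1) The following four identities hold: \begin{align*} \sum_{i,j,k\ge 0}\frac{q^{i^2+2j^2+4k^2+2ik+4jk}}{(q^2;q^2)_i(q^2;q^2)_j(q^4;q^4)_k}&=\frac{(q^5,q^6,q^{11};q^{11})_\infty}{(q;q^2)_\infty(q^4;q^4)_\infty},\\ \sum_{i,j,k\ge 0}\frac{q^{i^2+2j^2+4k^2+2ik+4jk+2k}}{(q^2;q^2)_i(q^2;q^2)_j(q^4;q^4)_k}&=\frac{(q^4,q^7,q^{11};q^{11})_\infty}{(q;q^2)_\infty(q^4;q^4)_\infty},\\ \sum_{i,j,k\ge 0}\frac{q^{i^2+2j^2+4k^2+2ik+4jk+2j+4k}}{(q^2;q^2)_i(q^2;q^2)_j(q^4;q^4)_k}&=\frac{(q^2,q^9,q^{11};q^{11})_\infty}{(q;q^2)_\infty(q^4;q^4)_\infty},\\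 \sum_{i,j,k\ge 0}\frac{q^{i^2+2j^2+4k^2+2ik+4jk+2i+2j+4k}}{(q^2;q^2)_i(q^2;q^2)_j(q^4;q^4)_k}&=\frac{(q,q^{10},q^{11};q^{11})_\infty}{(q;q^2)_\infty(q^4;q^4)_\infty}. \end{align*} For $k\ge 1$ and $n_1,\dots,n_k\ge 0$ write $N_j=n_j+n_{j+1}+\cdots+n_k$ for $1\le j\le k$; the sum $N_i+\cdots+N_k$ is $0$ when $i=k+1$. (2) For all integers $k\ge 1$ and $1\le i\le k+1$, $$\sum_{m,n_1,\dots,n_k\ge 0}\frac{q^{\frac12 m^2+mn_k+N_1^2+\cdots+N_k^2+N_i+N_{i+1}+\cdots+N_k}}{(q;q)_m(q;q)_{n_1}\cdots(q;q)_{n_{k-1}}(q^2;q^2)_{n_k}}=\frac{(-q^{\frac12};q)_\infty\,(q^{i},q^{\frac32+2k-i},q^{\frac32+2k};q^{\frac32+2k})_\infty}{(q;q)_\infty}.$$ (3) For all integers $k\ge 1$, $$\sum_{m,n_1,\dots,n_k\ge 0}\frac{q^{\frac12 m^2+mn_k+N_1^2+\cdots+N_k^2+m+N_1+\cdots+N_k}}{(q;q)_m(q;q)_{n_1}\cdots(q;q)_{n_{k-1}}(q^2;q^2)_{n_k}}=\frac{(-q^{\frac12};q)_\infty\,(q^{\frac12},q^{1+2k},q^{\frac32+2k};q^{\frac32+2k})_\infty}{(q;q)_\infty}.$$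 -/

import Mathlib

/-- The finite `q`-shifted factorial `(a; q)_n = ∏_{j=0}^{n-1} (1 - a q^j)`. -/
noncomputable def qPoch (a q : ℂ) (n : ℕ) : ℂ :=
  ∏ j ∈ Finset.range n, (1 - a * q ^ j)

/-- The infinite `q`-shifted factorial `(a; q)_∞ = ∏_{j≥0} (1 - a q^j)`, meant for `‖q‖ < 1`. -/
noncomputable def qPochInf (a q : ℂ) : ℂ :=
  ∏' j : ℕ, (1 - a * q ^ j)

/-- `(a, b, c; q)_∞ = (a; q)_∞ (b; q)_∞ (c; q)_∞`. -/
noncomputable def qPochInf₃ (a b c q : ℂ) : ℂ :=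
  qPochInf a q * qPochInf b q * qPochInf c q

/-- For `‖q‖ < 1` the infinite product defining `(a; q)_∞` converges, so `qPochInf` is its value. -/
theorem hasProd_qPochInf (a q : ℂ) (hq : ‖q‖ < 1) :
    HasProd (fun j : ℕ => 1 - a * q ^ j) (qPochInf a q) := by
  have h : Multipliable (fun j : ℕ => 1 + -(a * q ^ j)) := by
    apply multipliable_one_add_of_summable
    simp only [norm_neg, norm_mul, norm_pow]
    exact (summable_geometric_of_lt_one (norm_nonneg q) hq).mul_left _
  simpa only [← sub_eq_add_neg, qPochInf] using h.hasProd

/-- The entry `n_j` (`1 ≤ j ≤ k`) of the tuple `n = (n_1, …, n_k)`, which is indexed by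
`Fin k = {0, …, k-1}`; it is `0` for all other `j`. -/
def nahmEntry {k : ℕ} (n : Fin k → ℕ) (j : ℕ) : ℕ :=
  if h : 1 ≤ j ∧ j ≤ k then n ⟨j - 1, by omega⟩ else 0

/-- `N_j = n_j + n_{j+1} + ⋯ + n_k`; this is `0` for `j > k`. -/
def nahmN {k : ℕ} (n : Fin k → ℕ) (j : ℕ) : ℕ :=
  ∑ l ∈ Finset.Icc j k, nahmEntry n l

/-- The product `(q; q)_m (q; q)_{n_1} ⋯ (q; q)_{n_{k-1}} (q²; q²)_{n_k}`, for `k ≥ 1`. -/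
noncomputable def nahmDenom (q : ℂ) {k : ℕ} (m : ℕ) (n : Fin k → ℕ) : ℂ :=
  qPoch q q m * (∏ j ∈ Finset.Icc 1 (k - 1), qPoch q q (nahmEntry n j)) *
    qPoch (q ^ 2) (q ^ 2) (nahmEntry n k)

/-- The product `(q²; q²)_i (q²; q²)_j (q⁴; q⁴)_k`. -/
noncomputable def tripleDenom (q : ℂ) (i j k : ℕ) : ℂ :=
  qPoch (q ^ 2) (q ^ 2) i * qPoch (q ^ 2) (q ^ 2) j * qPoch (q ^ 4) (q ^ 4) k

theorem one_sub_pow_succ_ne_zero {q : ℂ} (hq : ‖q‖ < 1) (n : ℕ) : 1 - q ^ (n + 1) ≠ 0 := by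
  intro h
  have h1 : ‖q ^ (n + 1)‖ = 1 := by rw [← sub_eq_zero.mp h]; simp
  rw [norm_pow] at h1
  exact absurd h1 (pow_lt_one₀ (norm_nonneg q) hq (Nat.succ_ne_zero n)).ne

theorem qPoch_zero (a q : ℂ) : qPoch a q 0 = 1 := by simp [qPoch]

theorem qPoch_succ (a q : ℂ) (n : ℕ) :
    qPoch a q (n + 1) = qPoch a q n * (1 - a * q ^ n) := by
  simp [qPoch, Finset.prod_range_succ]

theorem qPoch_self_succ (q : ℂ) (n : ℕ) :
    qPoch q q (n + 1) = qPoch q q n * (1 - q ^ (n + 1)) := by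
  rw [qPoch_succ, pow_succ']

theorem qPoch_self_ne_zero {q : ℂ} (hq : ‖q‖ < 1) (n : ℕ) : qPoch q q n ≠ 0 := by
  refine Finset.prod_ne_zero_iff.mpr fun j _ => ?_
  rw [← pow_succ']
  exact one_sub_pow_succ_ne_zero hq j

/-- The reciprocal `1 / (q; q)_m`, extended by `0` to negative `m`. -/
noncomputable def invPoch (q : ℂ) (m : ℤ) : ℂ :=
  if 0 ≤ m then (qPoch q q m.toNat)⁻¹ else 0

theorem invPoch_natCast (q : ℂ) (n : ℕ) : invPoch q n = (qPoch q q n)⁻¹ := by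
  simp [invPoch]

theorem invPoch_of_neg (q : ℂ) {m : ℤ} (hm : m < 0) : invPoch q m = 0 := by
  simp [invPoch, hm]

theorem invPoch_zero (q : ℂ) : invPoch q 0 = 1 := by
  simp [invPoch, qPoch_zero]

theorem invPoch_eq_succ {q : ℂ} (hq : ‖q‖ < 1) (m : ℤ) :
    invPoch q m = (1 - q ^ (m + 1)) * invPoch q (m + 1) := by
  rcases lt_trichotomy m (-1) with h | rfl | h
  · rw [invPoch_of_neg q (by omega), invPoch_of_neg q (by omega), mul_zero]
  · rw [invPoch_of_neg q (by omega)]; simp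
  · lift m to ℕ using (by omega)
    have h1 := one_sub_pow_succ_ne_zero hq m
    have h2 := qPoch_self_ne_zero hq m
    have h3 : ((m : ℤ) + 1) = ((m + 1 : ℕ) : ℤ) := by push_cast; rfl
    rw [h3, invPoch_natCast, invPoch_natCast, qPoch_self_succ, zpow_natCast]
    field_simp

/-- The bilateral Bailey transform `∑_r c_r / ((q; q)_{n - r} (q; q)_{n + r + e})`. -/
noncomputable def baileySum (q : ℂ) (e : ℕ) (c : ℤ → ℂ) (n : ℕ) : ℂ :=
  ∑' r : ℤ, c r * (invPoch q (n - r) * invPoch q (n + r + e))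

theorem summable_baileySum (q : ℂ) (e : ℕ) (c : ℤ → ℂ) (n : ℕ) :
    Summable fun r : ℤ => c r * (invPoch q (n - r) * invPoch q (n + r + e)) := by
  refine summable_of_ne_finset_zero (s := Finset.Icc (-(n + e : ℤ)) n) fun r hr => ?_
  rw [Finset.mem_Icc, not_and_or] at hr
  rcases hr with hr | hr
  · rw [invPoch_of_neg q (m := n + r + e) (by omega)]; simp
  · rw [invPoch_of_neg q (m := n - r) (by omega)]; simp

theorem baileySum_zero_index (q : ℂ) (c : ℤ → ℂ) : baileySum q 0 c 0 = c 0 := by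
  rw [baileySum, tsum_eq_single 0]
  · simp [invPoch_zero]
  · intro r hr
    rcases lt_or_gt_of_ne hr with h | h
    · rw [invPoch_of_neg q (m := (0 : ℕ) + r + (0 : ℕ)) (by simpa using h)]; simp
    · rw [invPoch_of_neg q (m := (0 : ℕ) - r) (by simpa using h)]; simp

theorem baileySum_sub (q : ℂ) (e : ℕ) (c d : ℤ → ℂ) (n : ℕ) :
    baileySum q e (fun r => c r - d r) n = baileySum q e c n - baileySum q e d n := by
  rw [baileySum, baileySum, baileySum,
    ← (summable_baileySum q e c n).tsum_sub (summable_baileySum q e d n)]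
  simp only [sub_mul]

theorem baileySum_const_mul (q : ℂ) (e : ℕ) (x : ℂ) (c : ℤ → ℂ) (n : ℕ) :
    baileySum q e (fun r => x * c r) n = x * baileySum q e c n := by
  rw [baileySum, baileySum, ← tsum_mul_left]
  simp only [mul_assoc]

/-- The kernel is invariant under `r ↦ -r - e`. -/
theorem baileySum_reflect (q : ℂ) (e : ℕ) (c : ℤ → ℂ) (n : ℕ) :
    baileySum q e (fun r => c (-r - e)) n = baileySum q e c n := by
  rw [baileySum, baileySum, ← (Equiv.subLeft (-(e : ℤ))).tsum_eq]
  refine tsum_congr fun r => ?_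
  rw [Equiv.subLeft_apply]
  ring_nf

theorem baileySum_zero_eq_one {q : ℂ} (hq : ‖q‖ < 1) (hq0 : q ≠ 0) (c : ℤ → ℂ) (n : ℕ) :
    baileySum q 0 c n =
      baileySum q 1 c n - q ^ (n + 1) * baileySum q 1 (fun r => q ^ r * c r) n := by
  rw [← baileySum_const_mul, ← baileySum_sub]
  refine tsum_congr fun r => ?_
  have h := invPoch_eq_succ hq (n + r)
  have h2 : q ^ ((n : ℤ) + r + 1) = q ^ (n + 1) * q ^ r := by
    rw [← zpow_natCast, ← zpow_add₀ hq0]; push_cast; ring_nf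
  push_cast
  rw [add_zero, h, h2]
  ring

theorem baileySum_zero_eq_one_shift {q : ℂ} (hq : ‖q‖ < 1) (hq0 : q ≠ 0) (c : ℤ → ℂ) (n : ℕ) :
    baileySum q 0 c n = baileySum q 1 (fun r => c (r + 1)) n -
      q ^ n * baileySum q 1 (fun r => q ^ (-r) * c (r + 1)) n := by
  rw [← baileySum_const_mul, ← baileySum_sub, baileySum, baileySum,
    ← (Equiv.addRight (1 : ℤ)).tsum_eq]
  refine tsum_congr fun r => ?_
  have h := invPoch_eq_succ hq (n - r - 1)
  have h2 : q ^ ((n : ℤ) - r) = q ^ n * q ^ (-r) := by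
    rw [← zpow_natCast, ← zpow_add₀ hq0]; ring_nf
  rw [sub_add_cancel, h2] at h
  simp only [Equiv.coe_addRight]
  push_cast
  rw [add_zero, ← sub_sub, h, ← add_assoc]
  ring

theorem baileySum_one_eq_zero {q : ℂ} (hq : ‖q‖ < 1) (hq0 : q ≠ 0) (c : ℤ → ℂ) (n : ℕ) :
    baileySum q 1 c n = baileySum q 0 c (n + 1) -
      q ^ (n + 1) * baileySum q 0 (fun r => q ^ (-r) * c r) (n + 1) := by
  rw [← baileySum_const_mul, ← baileySum_sub]
  refine tsum_congr fun r => ?_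
  have h := invPoch_eq_succ hq (n - r)
  have h2 : q ^ ((n : ℤ) - r + 1) = q ^ (n + 1) * q ^ (-r) := by
    rw [← zpow_natCast, ← zpow_add₀ hq0]; push_cast; ring_nf
  have h3 : ((n + 1 : ℕ) : ℤ) - r = n - r + 1 := by push_cast; ring
  have h4 : ((n + 1 : ℕ) : ℤ) + r + (0 : ℕ) = n + r + (1 : ℕ) := by push_cast; ring
  rw [h3, h4, h, h2]
  ring

/-- The `q`-Chu–Vandermonde sum behind Bailey's lemma. -/
theorem sum_qVandermonde {q : ℂ} (hq : ‖q‖ < 1) (M c : ℕ) :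
    ∑ t ∈ Finset.range (M + 1), q ^ (t * (t + c)) *
      ((qPoch q q (M - t))⁻¹ * (qPoch q q t)⁻¹ * (qPoch q q (t + c))⁻¹) =
      (qPoch q q M)⁻¹ * (qPoch q q (M + c))⁻¹ := by
  induction M generalizing c with
  | zero => simp [qPoch_zero]
  | succ M ih =>
    have hM := one_sub_pow_succ_ne_zero hq M
    have key : (1 - q ^ (M + 1)) * ∑ t ∈ Finset.range (M + 1 + 1), q ^ (t * (t + c)) *
        ((qPoch q q (M + 1 - t))⁻¹ * (qPoch q q t)⁻¹ * (qPoch q q (t + c))⁻¹) =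
        (∑ t ∈ Finset.range (M + 1), q ^ (t * (t + c)) *
          ((qPoch q q (M - t))⁻¹ * (qPoch q q t)⁻¹ * (qPoch q q (t + c))⁻¹)) +
        q ^ (M + 1 + c) * ∑ t ∈ Finset.range (M + 1), q ^ (t * (t + (c + 1))) *
          ((qPoch q q (M - t))⁻¹ * (qPoch q q t)⁻¹ * (qPoch q q (t + (c + 1)))⁻¹) := by
      have split : ∀ t ∈ Finset.range (M + 1 + 1), (1 - q ^ (M + 1)) * (q ^ (t * (t + c)) *
          ((qPoch q q (M + 1 - t))⁻¹ * (qPoch q q t)⁻¹ * (qPoch q q (t + c))⁻¹)) =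
          (1 - q ^ (M + 1 - t)) * (q ^ (t * (t + c)) *
            ((qPoch q q (M + 1 - t))⁻¹ * (qPoch q q t)⁻¹ * (qPoch q q (t + c))⁻¹)) +
          q ^ (M + 1 - t) * (1 - q ^ t) * (q ^ (t * (t + c)) *
            ((qPoch q q (M + 1 - t))⁻¹ * (qPoch q q t)⁻¹ * (qPoch q q (t + c))⁻¹)) := by
        intro t ht
        have : q ^ (M + 1) = q ^ (M + 1 - t) * q ^ t := by
          rw [← pow_add, Nat.sub_add_cancel (by simpa [Nat.lt_succ_iff] using ht)]
        rw [this]; ring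
      rw [Finset.mul_sum, Finset.sum_congr rfl split, Finset.sum_add_distrib,
        Finset.sum_range_succ _ (M + 1), Finset.sum_range_succ' _ (M + 1), Finset.mul_sum]
      simp only [Nat.sub_self, pow_zero, sub_self, zero_mul, mul_zero, add_zero]
      congr 1
      · refine Finset.sum_congr rfl fun t ht => ?_
        have ht' : t ≤ M := by simpa [Nat.lt_succ_iff] using ht
        have h1 := one_sub_pow_succ_ne_zero hq (M - t)
        rw [Nat.succ_sub ht', qPoch_self_succ, mul_inv]
        field_simp
      · refine Finset.sum_congr rfl fun t ht => ?_
        have ht' : t ≤ M := by simpa [Nat.lt_succ_iff] using ht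
        have h1 := one_sub_pow_succ_ne_zero hq t
        have h2 : q ^ (M - t) * q ^ ((t + 1) * (t + 1 + c)) =
            q ^ (M + 1 + c) * q ^ (t * (t + (c + 1))) := by
          obtain ⟨u, rfl⟩ := Nat.exists_eq_add_of_le ht'
          rw [← pow_add, ← pow_add, Nat.add_sub_cancel_left]
          congr 1; ring
        rw [Nat.add_sub_add_right, qPoch_self_succ q t, mul_inv, add_right_comm t 1 c, ← add_assoc t c 1]
        rw [← add_assoc, add_right_comm t 1 c] at h2
        calc _ = (q ^ (M - t) * q ^ ((t + 1) * (t + c + 1))) * ((qPoch q q (M - t))⁻¹ *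
              (qPoch q q t)⁻¹ * (qPoch q q (t + c + 1))⁻¹) *
              ((1 - q ^ (t + 1)) * (1 - q ^ (t + 1))⁻¹) := by ring
          _ = _ := by rw [h2, mul_inv_cancel₀ h1]; ring
    refine mul_left_cancel₀ hM ?_
    have h3 := one_sub_pow_succ_ne_zero hq (M + c)
    have h4 := qPoch_self_ne_zero hq (M + c)
    have h5 := qPoch_self_ne_zero hq M
    rw [key, ih, ih, qPoch_self_succ q M, show M + 1 + c = M + c + 1 by ring,
      show M + (c + 1) = M + c + 1 by ring, qPoch_self_succ q (M + c)]
    field_simp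
    ring

theorem sum_invPoch_natCast {q : ℂ} (hq : ‖q‖ < 1) (e N r : ℕ) :
    ∑ n ∈ Finset.range (N + 1), q ^ (n ^ 2 + e * n) * (qPoch q q (N - n))⁻¹ *
      (invPoch q (n - r) * invPoch q (n + r + e)) =
      q ^ (r ^ 2 + e * r) * (invPoch q (N - r) * invPoch q (N + r + e)) := by
  rcases lt_or_ge N r with h | h
  · rw [invPoch_of_neg q (m := N - r) (by omega), zero_mul, mul_zero]
    refine Finset.sum_eq_zero fun n hn => ?_
    rw [invPoch_of_neg q (m := n - r) (by rw [Finset.mem_range] at hn; omega), zero_mul, mul_zero]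
  · obtain ⟨M, rfl⟩ := Nat.exists_eq_add_of_le h
    rw [add_assoc, Finset.sum_range_add, Finset.sum_eq_zero, zero_add]
    · have h1 : ((r + M : ℕ) : ℤ) - r = (M : ℕ) := by push_cast; ring
      have h2 : ((r + M : ℕ) : ℤ) + r + e = ((M + (2 * r + e) : ℕ) : ℤ) := by push_cast; ring
      rw [h1, h2, invPoch_natCast, invPoch_natCast, ← sum_qVandermonde hq, Finset.mul_sum]
      refine Finset.sum_congr rfl fun t _ => ?_
      have h1 : ((r + t : ℕ) : ℤ) - r = (t : ℕ) := by push_cast; ring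
      have h2 : ((r + t : ℕ) : ℤ) + r + e = ((t + (2 * r + e) : ℕ) : ℤ) := by push_cast; ring
      rw [h1, h2, invPoch_natCast, invPoch_natCast, Nat.add_sub_add_left,
        show (r + t) ^ 2 + e * (r + t) = (r ^ 2 + e * r) + t * (t + (2 * r + e)) by ring, pow_add]
      ring
    · intro n hn
      rw [invPoch_of_neg q (m := n - r) (by rw [Finset.mem_range] at hn; omega), zero_mul, mul_zero]

theorem sum_invPoch {q : ℂ} (hq : ‖q‖ < 1) {e : ℕ} (he : e ≤ 1) (N : ℕ) (r : ℤ) :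
    ∑ n ∈ Finset.range (N + 1), q ^ (n ^ 2 + e * n) * (qPoch q q (N - n))⁻¹ *
      (invPoch q (n - r) * invPoch q (n + r + e)) =
      q ^ (r ^ 2 + e * r) * (invPoch q (N - r) * invPoch q (N + r + e)) := by
  rcases le_or_gt 0 r with h | h
  · lift r to ℕ using h
    rw [sum_invPoch_natCast hq, ← zpow_natCast]
    push_cast
    rfl
  · obtain ⟨t, ht⟩ : ∃ t : ℕ, r = -t - e := ⟨(-r - e).toNat, by omega⟩
    subst ht
    have h0 := sum_invPoch_natCast hq e N t
    rw [← zpow_natCast] at h0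
    have key : ∀ n : ℤ, invPoch q (n - (-t - e)) * invPoch q (n + (-t - e) + e) =
        invPoch q (n - t) * invPoch q (n + t + e) := by
      intro n
      rw [mul_comm]; congr 2 <;> ring
    simp only [key]
    rw [h0]
    push_cast
    ring_nf

/-- One step along the Bailey chain. -/
noncomputable def baileyStep (q : ℂ) (e : ℕ) (b : ℕ → ℂ) (N : ℕ) : ℂ :=
  ∑ n ∈ Finset.range (N + 1), q ^ (n ^ 2 + e * n) * (qPoch q q (N - n))⁻¹ * b n

/-- Bailey's lemma for the parameters `a = 1` (`e = 0`) and `a = q` (`e = 1`). -/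
theorem baileyStep_baileySum {q : ℂ} (hq : ‖q‖ < 1) {e : ℕ} (he : e ≤ 1) (c : ℤ → ℂ) :
    baileyStep q e (baileySum q e c) = baileySum q e fun r => q ^ (r ^ 2 + e * r) * c r := by
  funext N
  simp only [baileyStep, baileySum, ← tsum_mul_left]
  rw [← Summable.tsum_finsetSum fun n _ => (summable_baileySum q e c n).mul_left _]
  refine tsum_congr fun r => ?_
  rw [mul_right_comm, ← sum_invPoch hq he, Finset.sum_mul]
  exact Finset.sum_congr rfl fun n _ => by ring

/-- The triangular number `r (r - 1) / 2`. -/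
def tri (r : ℤ) : ℤ := r * (r - 1) / 2

theorem two_mul_tri (r : ℤ) : 2 * tri r = r * (r - 1) :=
  Int.mul_ediv_cancel' (Int.even_mul_pred_self r).two_dvd

theorem tri_succ (r : ℤ) : tri (r + 1) = tri r + r := by
  have h1 := two_mul_tri r
  have h2 := two_mul_tri (r + 1)
  linarith

theorem tri_neg (r : ℤ) : tri (-r) = tri r + r := by
  have h1 := two_mul_tri r
  have h2 := two_mul_tri (-r)
  linarith

theorem tri_zero : tri 0 = 0 := rfl

/-- The coefficients `(-1)^r s^{a r (r - 1) / 2 + b r}` of a theta series. -/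
noncomputable def thetaCoeff (s : ℂ) (a b r : ℤ) : ℂ :=
  (-1) ^ r * s ^ (a * tri r + b * r)

theorem thetaCoeff_zero (s : ℂ) (a b : ℤ) : thetaCoeff s a b 0 = 1 := by
  simp [thetaCoeff, tri_zero]

theorem zpow_mul_thetaCoeff {s : ℂ} (hs : s ≠ 0) (x y a b r : ℤ) :
    s ^ (x * tri r + y * r) * thetaCoeff s a b r = thetaCoeff s (a + x) (b + y) r := by
  rw [thetaCoeff, thetaCoeff, mul_left_comm, ← zpow_add₀ hs]
  ring_nf

theorem thetaCoeff_succ {s : ℂ} (hs : s ≠ 0) (a b r : ℤ) :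
    thetaCoeff s a b (r + 1) = -(s ^ b * thetaCoeff s a (a + b) r) := by
  rw [thetaCoeff, thetaCoeff, tri_succ, mul_left_comm, ← zpow_add₀ hs,
    zpow_add_one₀ (by norm_num : (-1 : ℂ) ≠ 0)]
  ring_nf

theorem thetaCoeff_neg (s : ℂ) (a b r : ℤ) :
    thetaCoeff s a b (-r) = thetaCoeff s a (a - b) r := by
  rw [thetaCoeff, thetaCoeff, tri_neg, zpow_neg, ← inv_zpow, inv_neg_one]
  ring_nf

theorem thetaCoeff_neg_sub_one {s : ℂ} (hs : s ≠ 0) (a b r : ℤ) :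
    thetaCoeff s a b (-r - 1) = -(s ^ (a - b) * thetaCoeff s a (2 * a - b) r) := by
  rw [← neg_add', thetaCoeff_neg, thetaCoeff_succ hs]
  ring_nf

section BaseCases

variable {q s : ℂ}

theorem sq_zpow_mul_thetaCoeff (hs : s ≠ 0) (hsq : s ^ 2 = q) (a b r : ℤ) :
    q ^ r * thetaCoeff s a b r = thetaCoeff s a (b + 2) r := by
  have h := zpow_mul_thetaCoeff hs 0 2 a b r
  rw [zero_mul, zero_add, add_zero, zpow_mul] at h
  rw [← h, ← hsq]
  norm_cast

theorem baileySum_one_thetaCoeff (hs : s ≠ 0) (a b : ℤ) (n : ℕ) :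
    baileySum q 1 (thetaCoeff s a b) n =
      -(s ^ (a - b) * baileySum q 1 (thetaCoeff s a (2 * a - b)) n) := by
  rw [← neg_mul, ← baileySum_const_mul, ← baileySum_reflect]
  congr 1
  funext r
  rw [Nat.cast_one, thetaCoeff_neg_sub_one hs, neg_mul]

theorem baileySum_one_thetaCoeff_self (hs : s ≠ 0) (a : ℤ) (n : ℕ) :
    baileySum q 1 (thetaCoeff s a a) n = 0 := by
  have h := baileySum_one_thetaCoeff (q := q) hs a a n
  rw [sub_self, zpow_zero, one_mul, show 2 * a - a = a by ring] at h
  exact CharZero.eq_neg_self_iff.mp h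

theorem baileySum_zero_thetaCoeff (a b : ℤ) (n : ℕ) :
    baileySum q 0 (thetaCoeff s a b) n = baileySum q 0 (thetaCoeff s a (a - b)) n := by
  rw [← baileySum_reflect]
  congr 1
  funext r
  rw [Nat.cast_zero, sub_zero, thetaCoeff_neg]

variable (hq : ‖q‖ < 1) (hs : s ≠ 0) (hsq : s ^ 2 = q)
include hq hs hsq

/-- Passage from `a = q` to `a = 1` in a Bailey chain. -/
theorem baileySum_zero_eq_one_thetaCoeff {a b : ℤ} (hab : a = b + 2) (n : ℕ) :
    baileySum q 0 (thetaCoeff s a b) n = baileySum q 1 (thetaCoeff s a b) n := by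
  subst hab
  have hq0 : q ≠ 0 := hsq ▸ pow_ne_zero 2 hs
  rw [baileySum_zero_eq_one hq hq0]
  simp only [sq_zpow_mul_thetaCoeff hs hsq]
  rw [baileySum_one_thetaCoeff_self hs, mul_zero, sub_zero]

theorem baileySum_zero_thetaCoeff_three_zero (n : ℕ) :
    baileySum q 0 (thetaCoeff s 3 0) n = q ^ n * baileySum q 0 (thetaCoeff s 3 1) n := by
  have hq0 : q ≠ 0 := hsq ▸ pow_ne_zero 2 hs
  rw [baileySum_zero_eq_one_shift hq hq0,
    baileySum_zero_eq_one_thetaCoeff hq hs hsq (by norm_num) n]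
  have h1 : (fun r => thetaCoeff s 3 0 (r + 1)) = fun r => -1 * thetaCoeff s 3 3 r := by
    funext r; rw [thetaCoeff_succ hs]; simp
  have h2 : (fun r => q ^ (-r) * thetaCoeff s 3 0 (r + 1)) =
      fun r => -1 * thetaCoeff s 3 1 r := by
    funext r
    have h := sq_zpow_mul_thetaCoeff hs hsq 3 1 r
    have hr : q ^ r ≠ 0 := zpow_ne_zero r hq0
    rw [show (1 : ℤ) + 2 = 3 by norm_num] at h
    rw [thetaCoeff_succ hs, zpow_neg, zpow_zero, one_mul, add_zero, ← h]
    field_simp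
  rw [h1, h2, baileySum_const_mul, baileySum_const_mul, baileySum_one_thetaCoeff_self hs]
  ring

theorem baileySum_thetaCoeff_three_two (n : ℕ) :
    baileySum q 0 (thetaCoeff s 3 1) n =
      (1 + s ^ (2 * n + 1)) * baileySum q 1 (thetaCoeff s 3 2) n := by
  have hq0 : q ≠ 0 := hsq ▸ pow_ne_zero 2 hs
  rw [baileySum_zero_thetaCoeff, show (3 : ℤ) - 1 = 2 by norm_num, baileySum_zero_eq_one hq hq0]
  simp only [sq_zpow_mul_thetaCoeff hs hsq]
  rw [baileySum_one_thetaCoeff hs 3 (2 + 2), ← hsq]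
  norm_num
  field_simp
  ring

theorem baileySum_one_thetaCoeff_three_two (n : ℕ) :
    baileySum q 1 (thetaCoeff s 3 2) n =
      (1 - (q ^ 2) ^ (n + 1)) * baileySum q 0 (thetaCoeff s 3 1) (n + 1) := by
  have hq0 : q ≠ 0 := hsq ▸ pow_ne_zero 2 hs
  rw [baileySum_one_eq_zero hq hq0]
  have h2 : (fun r => q ^ (-r) * thetaCoeff s 3 2 r) = thetaCoeff s 3 0 := by
    funext r
    have h := sq_zpow_mul_thetaCoeff hs hsq 3 0 r
    have hr : q ^ r ≠ 0 := zpow_ne_zero r hq0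
    rw [zpow_neg, ← zero_add (2 : ℤ), ← h]
    field_simp
  rw [h2, baileySum_zero_thetaCoeff_three_zero hq hs hsq, baileySum_zero_thetaCoeff 3 2]
  norm_num
  ring

omit hs in
theorem one_add_mul_pow_ne_zero (n : ℕ) : 1 + s * q ^ n ≠ 0 := by
  have hs1 : ‖s‖ < 1 := by
    rw [← hsq, norm_pow] at hq
    exact (pow_lt_one_iff_of_nonneg (norm_nonneg s) two_ne_zero).mp hq
  intro h
  have h1 : ‖s ^ (2 * n + 1)‖ = 1 := by
    rw [pow_succ', pow_mul, hsq, eq_neg_of_add_eq_zero_right h]; simp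
  rw [norm_pow] at h1
  exact absurd h1 (pow_lt_one₀ (norm_nonneg s) hs1 (Nat.succ_ne_zero _)).ne

omit hs in
theorem qPoch_neg_ne_zero (n : ℕ) : qPoch (-s) q n ≠ 0 := by
  refine Finset.prod_ne_zero_iff.mpr fun j _ => ?_
  rw [neg_mul, sub_neg_eq_add]
  exact one_add_mul_pow_ne_zero hq hsq j

theorem baileySum_one_thetaCoeff_eq (n : ℕ) :
    baileySum q 1 (thetaCoeff s 3 2) n =
      (qPoch (q ^ 2) (q ^ 2) n * qPoch (-s) q (n + 1))⁻¹ ∧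
    baileySum q 0 (thetaCoeff s 3 1) n =
      (qPoch (q ^ 2) (q ^ 2) n * qPoch (-s) q n)⁻¹ := by
  have hq2 : ‖q ^ 2‖ < 1 := by
    rw [norm_pow]; exact pow_lt_one₀ (norm_nonneg q) hq two_ne_zero
  have step : ∀ n, baileySum q 0 (thetaCoeff s 3 1) n =
      (qPoch (q ^ 2) (q ^ 2) n * qPoch (-s) q n)⁻¹ → baileySum q 1 (thetaCoeff s 3 2) n =
      (qPoch (q ^ 2) (q ^ 2) n * qPoch (-s) q (n + 1))⁻¹ := by
    intro n h
    have h1 := one_add_mul_pow_ne_zero hq hsq n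
    have h2 := baileySum_thetaCoeff_three_two hq hs hsq n
    rw [pow_succ', pow_mul, hsq, h] at h2
    rw [qPoch_succ (-s), neg_mul, sub_neg_eq_add, ← mul_assoc, mul_inv, h2]
    field_simp
  have base : baileySum q 0 (thetaCoeff s 3 1) n =
      (qPoch (q ^ 2) (q ^ 2) n * qPoch (-s) q n)⁻¹ := by
    induction n with
    | zero => rw [baileySum_zero_index, thetaCoeff_zero, qPoch_zero, qPoch_zero]; simp
    | succ n ih =>
      have h1 := one_sub_pow_succ_ne_zero hq2 n
      have h2 := baileySum_one_thetaCoeff_three_two hq hs hsq n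
      rw [step n ih] at h2
      rw [qPoch_self_succ, mul_right_comm, mul_inv, h2]
      field_simp
  exact ⟨step n base, base⟩

theorem baileyStep_thetaCoeff {e : ℕ} (he : e ≤ 1) (a b : ℤ) :
    baileyStep q e (baileySum q e (thetaCoeff s a b)) =
      baileySum q e (thetaCoeff s (a + 4) (b + (2 + 2 * e))) := by
  rw [baileyStep_baileySum hq he]
  congr 1
  funext r
  rw [← zpow_mul_thetaCoeff hs]
  congr 1
  have h : q = s ^ (2 : ℤ) := by rw [← hsq]; norm_cast
  rw [h, ← zpow_mul]
  congr 1
  linear_combination -2 * two_mul_tri r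

end BaseCases

/-- `k` steps along the Bailey chain, with parameters `e 0, …, e (k - 1)` from the outside in. -/
noncomputable def baileyChain (q : ℂ) (b : ℕ → ℂ) : ℕ → (ℕ → ℕ) → ℕ → ℂ
  | 0, _ => b
  | k + 1, e => baileyStep q (e 0) (baileyChain q b k fun j => e (j + 1))

section Chain

variable {q s : ℂ} (hq : ‖q‖ < 1) (hs : s ≠ 0) (hsq : s ^ 2 = q)
include hq hs hsq

theorem baileyChain_one (b : ℤ) (k : ℕ) :
    baileyChain q (baileySum q 1 (thetaCoeff s 3 b)) k (fun _ => 1) =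
      baileySum q 1 (thetaCoeff s (4 * k + 3) (4 * k + b)) := by
  induction k with
  | zero => simp [baileyChain]
  | succ k ih =>
    rw [baileyChain, ih, baileyStep_thetaCoeff hq hs hsq le_rfl]
    push_cast
    ring_nf

theorem baileyChain_ite (k i : ℕ) (hi : 1 ≤ i) (hik : i ≤ k + 1) :
    baileyChain q (baileySum q 0 (thetaCoeff s 3 1)) k (fun j => if i ≤ j + 1 then 1 else 0) =
      baileySum q 0 (thetaCoeff s (4 * k + 3) (4 * k + 3 - 2 * i)) := by
  induction k generalizing i with
  | zero =>
    obtain rfl : i = 1 := by omega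
    simp [baileyChain]
  | succ k ih =>
    obtain ⟨i, rfl⟩ := Nat.exists_eq_add_of_le' hi
    rcases Nat.eq_zero_or_pos i with rfl | h
    · have h1 : baileySum q 0 (thetaCoeff s 3 1) = baileySum q 1 (thetaCoeff s 3 1) :=
        funext (baileySum_zero_eq_one_thetaCoeff hq hs hsq (by norm_num))
      simp only [zero_add, Nat.le_add_left, if_true]
      funext n
      rw [h1, baileyChain_one hq hs hsq, baileySum_zero_eq_one_thetaCoeff hq hs hsq
        (by push_cast; ring)]
      push_cast
      ring_nf
    · have h2 : ¬ i + 1 ≤ 0 + 1 := by omega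
      simp only [baileyChain, h2, if_false]
      have h3 := ih i h (by omega)
      simp only [Nat.add_le_add_iff_right]
      rw [h3, baileyStep_thetaCoeff hq hs hsq zero_le_one]
      push_cast
      ring_nf

end Chain

section Analysis

open Filter Topology

theorem tendsto_qPoch (a : ℂ) {q : ℂ} (hq : ‖q‖ < 1) :
    Tendsto (qPoch a q) atTop (𝓝 (qPochInf a q)) :=
  (hasProd_qPochInf a q hq).tendsto_prod_nat

theorem qPochInf_ne_zero {a q : ℂ} (hq : ‖q‖ < 1) (h : ∀ j : ℕ, 1 - a * q ^ j ≠ 0) :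
    qPochInf a q ≠ 0 := by
  have := tprod_one_add_ne_zero_of_summable (f := fun j : ℕ => -(a * q ^ j))
    (by simpa only [← sub_eq_add_neg] using h) (by
      simp only [norm_neg, norm_mul, norm_pow]
      exact (summable_geometric_of_lt_one (norm_nonneg q) hq).mul_left _)
  simpa only [← sub_eq_add_neg, qPochInf] using this

theorem qPochInf_self_ne_zero {q : ℂ} (hq : ‖q‖ < 1) : qPochInf q q ≠ 0 :=
  qPochInf_ne_zero hq fun j => by rw [← pow_succ']; exact one_sub_pow_succ_ne_zero hq j

theorem tendsto_invPoch {q : ℂ} (hq : ‖q‖ < 1) (m : ℤ) :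
    Tendsto (fun n : ℕ => invPoch q (n + m)) atTop (𝓝 (qPochInf q q)⁻¹) := by
  have h := (tendsto_qPoch q hq).inv₀ (qPochInf_self_ne_zero hq)
  have h2 : Tendsto (fun n : ℕ => ((n : ℤ) + m).toNat) atTop atTop := by
    refine tendsto_atTop_atTop.mpr fun b => ⟨(b - m).toNat, fun n hn => by omega⟩
  refine (h.comp h2).congr' ?_
  filter_upwards [eventually_ge_atTop (-m).toNat] with n hn
  rw [invPoch, if_pos (by omega)]
  rfl

theorem exists_norm_invPoch_le {q : ℂ} (hq : ‖q‖ < 1) :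
    ∃ C : ℝ, 0 ≤ C ∧ ∀ m : ℤ, ‖invPoch q m‖ ≤ C := by
  obtain ⟨C, hC⟩ := (Metric.isBounded_range_of_tendsto _ (tendsto_invPoch hq 0)).exists_norm_le
  have h : ∀ n : ℕ, ‖invPoch q n‖ ≤ C := fun n => hC _ ⟨n, by simp⟩
  have hC0 : 0 ≤ C := (norm_nonneg _).trans (h 0)
  refine ⟨C, hC0, fun m => ?_⟩
  rcases lt_or_ge m 0 with hm | hm
  · rwa [invPoch_of_neg q hm, norm_zero]
  · lift m to ℕ using hm
    exact h m

theorem tendsto_baileySum {q : ℂ} (hq : ‖q‖ < 1) (e : ℕ) {c : ℤ → ℂ} (hc : Summable c) :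
    Tendsto (baileySum q e c) atTop (𝓝 ((∑' r, c r) / qPochInf q q ^ 2)) := by
  obtain ⟨C, hC0, hC⟩ := exists_norm_invPoch_le hq
  have h1 : (∑' r, c r) / qPochInf q q ^ 2 =
      ∑' r, c r * ((qPochInf q q)⁻¹ * (qPochInf q q)⁻¹) := by
    rw [tsum_mul_right, div_eq_mul_inv, ← mul_inv, sq]
  rw [h1]
  refine tendsto_tsum_of_dominated_convergence (bound := fun r => ‖c r‖ * (C * C))
    (hc.norm.mul_right _) (fun r => ?_) (Eventually.of_forall fun n r => ?_)
  · refine Tendsto.const_mul _ (Tendsto.mul ?_ ?_)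
    · simpa only [sub_eq_add_neg] using tendsto_invPoch hq (-r)
    · simpa only [add_assoc] using tendsto_invPoch hq (r + e)
  · rw [norm_mul, norm_mul]
    gcongr
    · exact hC _
    · exact hC _

theorem summable_of_succ_eq {a : ℕ → ℂ} {w p : ℂ} (hp : ‖p‖ < 1)
    (h : ∀ m, a (m + 1) = w * p ^ m * a m) : Summable a := by
  have h1 : Tendsto (fun m : ℕ => ‖w * p ^ m‖) atTop (𝓝 0) := by
    simpa using ((tendsto_pow_atTop_nhds_zero_of_norm_lt_one hp).const_mul w).norm
  refine summable_of_ratio_norm_eventually_le (r := 1 / 2) (by norm_num) ?_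
  filter_upwards [h1.eventually_le_const (by norm_num : (0 : ℝ) < 1 / 2)] with m hm
  rw [h, norm_mul]
  gcongr

section JacobiTripleProduct

variable {p z : ℂ} {c : ℤ → ℂ} (hp : ‖p‖ < 1) (hp0 : p ≠ 0) (hz : z ≠ 0)
  (hc : ∀ r, c (r + 1) = -(z * p ^ r * c r))

include hp hp0 hz hc

theorem summable_theta : Summable c := by
  refine Summable.of_nat_of_neg ?_ ?_
  · refine summable_of_succ_eq (w := -z) hp fun m => ?_
    rw [Nat.cast_succ, hc, zpow_natCast]
    ring
  · refine summable_of_succ_eq (w := -(p / z)) hp fun m => ?_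
    have h := hc (-((m + 1 : ℕ) : ℤ))
    have h2 : p ^ (-((m + 1 : ℕ) : ℤ)) = (p * p ^ m)⁻¹ := by
      rw [zpow_neg, zpow_natCast, pow_succ']
    rw [h2, show -((m + 1 : ℕ) : ℤ) + 1 = -m by push_cast; ring] at h
    rw [h]
    have := pow_ne_zero m hp0
    field_simp

theorem baileySum_one_theta (n : ℕ) :
    (1 - p ^ (2 * n + 1)) * baileySum p 1 c n = (1 - p / z * p ^ n) * baileySum p 0 c n := by
  have h1 := baileySum_zero_eq_one hp hp0 c n
  have h2 := baileySum_zero_eq_one_shift hp hp0 c n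
  have e1 : (fun r => c (r + 1)) = fun r => -z * (p ^ r * c r) := by
    funext r; rw [hc]; ring
  have e2 : (fun r => p ^ (-r) * c (r + 1)) = fun r => -z * c r := by
    funext r
    have := zpow_ne_zero r hp0
    rw [hc, zpow_neg]
    field_simp
  rw [e1, e2, baileySum_const_mul, baileySum_const_mul] at h2
  field_simp
  linear_combination (-z) * h1 + p ^ (n + 1) * h2

theorem baileySum_zero_theta (n : ℕ) :
    (1 - p ^ (2 * n + 2)) * baileySum p 0 c (n + 1) = (1 - z * p ^ n) * baileySum p 1 c n := by
  have h1 := baileySum_one_eq_zero hp hp0 c n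
  have h2 : baileySum p 1 c n = baileySum p 0 (fun r => c (r - 1)) (n + 1) -
      p ^ (n + 1) * baileySum p 0 (fun r => p ^ r * c (r - 1)) (n + 1) := by
    rw [← baileySum_const_mul, ← baileySum_sub, baileySum, baileySum,
      ← (Equiv.subRight (1 : ℤ)).tsum_eq]
    refine tsum_congr fun r => ?_
    have h := invPoch_eq_succ hp (n + r)
    have h2 : p ^ ((n : ℤ) + r + 1) = p ^ (n + 1) * p ^ r := by
      rw [← zpow_natCast, ← zpow_add₀ hp0]; push_cast; ring_nf
    have h3 : ((n + 1 : ℕ) : ℤ) + r + (0 : ℕ) = n + r + 1 := by push_cast; ring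
    have h4 : (n : ℤ) + (r - 1) + (1 : ℕ) = n + r := by push_cast; ring
    have h5 : (n : ℤ) - (r - 1) = ((n + 1 : ℕ) : ℤ) - r := by push_cast; ring
    rw [h3, Equiv.subRight_apply, h4, h5, h, h2]
    ring
  have e1 : (fun r => c (r - 1)) = fun r => -(p / z) * (p ^ (-r) * c r) := by
    funext r
    have h := hc (r - 1)
    have := zpow_ne_zero r hp0
    rw [sub_add_cancel, zpow_sub_one₀ hp0] at h
    rw [h, zpow_neg]
    field_simp
  have e2 : (fun r => p ^ r * c (r - 1)) = fun r => -(p / z) * c r := by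
    funext r
    have := zpow_ne_zero r hp0
    rw [congrFun e1 r, zpow_neg]
    field_simp
  rw [e1, e2, baileySum_const_mul, baileySum_const_mul] at h2
  field_simp at h2
  refine mul_left_cancel₀ hp0 ?_
  linear_combination -p * h1 + p ^ (n + 1) * h2

/-- A finite form of the Jacobi triple product identity. -/
theorem baileySum_theta (hc0 : c 0 = 1) (n : ℕ) :
    baileySum p 0 c n = qPoch z p n * qPoch (p / z) p n * (qPoch p p (2 * n))⁻¹ := by
  induction n with
  | zero => rw [baileySum_zero_index, hc0]; simp [qPoch_zero]
  | succ n ih =>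
    have h1 := baileySum_one_theta hp hp0 hz hc n
    have h2 := baileySum_zero_theta hp hp0 hz hc n
    have n1 := one_sub_pow_succ_ne_zero hp (2 * n)
    have n2 := one_sub_pow_succ_ne_zero hp (2 * n + 1)
    have n3 := qPoch_self_ne_zero hp (2 * n)
    rw [qPoch_succ, qPoch_succ, show 2 * (n + 1) = 2 * n + 1 + 1 by ring, qPoch_self_succ,
      qPoch_self_succ]
    refine mul_left_cancel₀ (mul_ne_zero n1 n2) ?_
    calc _ = (1 - p ^ (2 * n + 1)) * ((1 - p ^ (2 * n + 2)) * baileySum p 0 c (n + 1)) := by ring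
      _ = (1 - z * p ^ n) * ((1 - p ^ (2 * n + 1)) * baileySum p 1 c n) := by rw [h2]; ring
      _ = _ := by
        rw [h1, ih]
        generalize p / z = y
        field_simp

/-- The Jacobi triple product identity. -/
theorem tsum_theta (hc0 : c 0 = 1) : ∑' r, c r = qPochInf₃ z (p / z) p p := by
  have h1 := tendsto_baileySum hp 0 (summable_theta hp hp0 hz hc)
  have h2 := ((tendsto_qPoch z hp).mul (tendsto_qPoch (p / z) hp)).mul
    (((tendsto_qPoch p hp).inv₀ (qPochInf_self_ne_zero hp)).comp
      (tendsto_id.const_mul_atTop' (by norm_num : 0 < 2)))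
  have h3 := tendsto_nhds_unique h1
    (h2.congr fun n => (baileySum_theta hp hp0 hz hc hc0 n).symm)
  have h4 := qPochInf_self_ne_zero hp
  rw [qPochInf₃]
  field_simp at h3
  rw [h3]
  ring

end JacobiTripleProduct

section ThetaSeries

variable {s : ℂ} (hs : s ≠ 0) (hs1 : ‖s‖ < 1) {a : ℕ} (ha : a ≠ 0) (b : ℤ)
include hs

theorem thetaCoeff_succ_eq (a b r : ℤ) :
    thetaCoeff s a b (r + 1) = -(s ^ b * (s ^ a) ^ r * thetaCoeff s a b r) := by
  have h := zpow_mul_thetaCoeff hs 0 a a b r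
  rw [thetaCoeff_succ hs, add_comm a b, ← zpow_mul, mul_assoc]
  simp only [zero_mul, zero_add, add_zero] at h
  rw [h]

include hs1 ha

theorem summable_thetaCoeff : Summable (thetaCoeff s a b) := by
  refine summable_theta (p := s ^ a) ?_ (pow_ne_zero a hs) (zpow_ne_zero b hs) fun r => ?_
  · rw [norm_pow]; exact pow_lt_one₀ (norm_nonneg s) hs1 ha
  · rw [thetaCoeff_succ_eq hs, zpow_natCast]

theorem tsum_thetaCoeff :
    ∑' r, thetaCoeff s a b r = qPochInf₃ (s ^ b) (s ^ (a - b)) (s ^ a) (s ^ a) := by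
  rw [zpow_sub₀ hs, zpow_natCast]
  refine tsum_theta ?_ (pow_ne_zero a hs) (zpow_ne_zero b hs) (fun r => ?_) (thetaCoeff_zero _ _ _)
  · rw [norm_pow]; exact pow_lt_one₀ (norm_nonneg s) hs1 ha
  · rw [thetaCoeff_succ_eq hs, zpow_natCast]

end ThetaSeries

/-- The finite `q`-binomial theorem. -/
theorem sum_qBinomial {q : ℂ} (hq : ‖q‖ < 1) (z : ℂ) (n : ℕ) :
    ∑ m ∈ Finset.range (n + 1), z ^ m * q ^ m.choose 2 *
      ((qPoch q q m)⁻¹ * (qPoch q q (n - m))⁻¹) = qPoch (-z) q n * (qPoch q q n)⁻¹ := by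
  induction n with
  | zero => simp [qPoch_zero]
  | succ n ih =>
    have hn := one_sub_pow_succ_ne_zero hq n
    have split : ∀ m ∈ Finset.range (n + 1 + 1), (1 - q ^ (n + 1)) * (z ^ m * q ^ m.choose 2 *
        ((qPoch q q m)⁻¹ * (qPoch q q (n + 1 - m))⁻¹)) =
        (1 - q ^ (n + 1 - m)) * (z ^ m * q ^ m.choose 2 *
          ((qPoch q q m)⁻¹ * (qPoch q q (n + 1 - m))⁻¹)) +
        q ^ (n + 1 - m) * (1 - q ^ m) * (z ^ m * q ^ m.choose 2 *
          ((qPoch q q m)⁻¹ * (qPoch q q (n + 1 - m))⁻¹)) := by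
      intro m hm
      have : q ^ (n + 1) = q ^ (n + 1 - m) * q ^ m := by
        rw [← pow_add, Nat.sub_add_cancel (by simpa [Nat.lt_succ_iff] using hm)]
      rw [this]; ring
    refine mul_left_cancel₀ hn ?_
    rw [qPoch_self_succ, qPoch_succ, Finset.mul_sum, Finset.sum_congr rfl split,
      Finset.sum_add_distrib, Finset.sum_range_succ _ (n + 1), Finset.sum_range_succ' _ (n + 1)]
    simp only [Nat.sub_self, pow_zero, sub_self, zero_mul, mul_zero, add_zero]
    have h1 : ∀ m ∈ Finset.range (n + 1), (1 - q ^ (n + 1 - m)) * (z ^ m * q ^ m.choose 2 *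
        ((qPoch q q m)⁻¹ * (qPoch q q (n + 1 - m))⁻¹)) = z ^ m * q ^ m.choose 2 *
        ((qPoch q q m)⁻¹ * (qPoch q q (n - m))⁻¹) := by
      intro m hm
      have hm' : m ≤ n := by simpa [Nat.lt_succ_iff] using hm
      have h1 := one_sub_pow_succ_ne_zero hq (n - m)
      rw [Nat.succ_sub hm', qPoch_self_succ, mul_inv]
      field_simp
    have h2 : ∀ m ∈ Finset.range (n + 1), q ^ (n + 1 - (m + 1)) * (1 - q ^ (m + 1)) *
        (z ^ (m + 1) * q ^ (m + 1).choose 2 *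
          ((qPoch q q (m + 1))⁻¹ * (qPoch q q (n + 1 - (m + 1)))⁻¹)) =
        z * q ^ n * (z ^ m * q ^ m.choose 2 * ((qPoch q q m)⁻¹ * (qPoch q q (n - m))⁻¹)) := by
      intro m hm
      have hm' : m ≤ n := by simpa [Nat.lt_succ_iff] using hm
      have h1 := one_sub_pow_succ_ne_zero hq m
      have h3 : q ^ n = q ^ (n - m) * q ^ m := by rw [← pow_add, Nat.sub_add_cancel hm']
      rw [Nat.add_sub_add_right, qPoch_self_succ, mul_inv, Nat.choose_succ_succ' m 1,
        Nat.choose_one_right, pow_add q m (m.choose (1 + 1)), h3]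
      field_simp
      ring
    rw [Finset.sum_congr rfl h1, Finset.sum_congr rfl h2, ← Finset.mul_sum, ih]
    field_simp
    ring

/-- Euler's identity `∑_m q^{m (m - 1) / 2} z^m / (q; q)_m = (-z; q)_∞`. -/
theorem hasSum_euler {q : ℂ} (hq : ‖q‖ < 1) (z : ℂ) :
    HasSum (fun m : ℕ => z ^ m * q ^ m.choose 2 * (qPoch q q m)⁻¹) (qPochInf (-z) q) := by
  obtain ⟨C, hC0, hC⟩ := exists_norm_invPoch_le hq
  have hsum : Summable fun m : ℕ => z ^ m * q ^ m.choose 2 := by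
    refine summable_of_succ_eq (w := z) hq fun m => ?_
    rw [Nat.choose_succ_succ, Nat.choose_one_right]
    ring
  have hCn : ∀ n : ℕ, ‖(qPoch q q n)⁻¹‖ ≤ C := fun n => invPoch_natCast q n ▸ hC n
  have hL := qPochInf_self_ne_zero hq
  have hsum2 : Summable fun m : ℕ => z ^ m * q ^ m.choose 2 * (qPoch q q m)⁻¹ := by
    refine (hsum.norm.mul_right C).of_norm_bounded fun m => ?_
    rw [norm_mul]
    gcongr
    exact hCn m
  have h1 : Tendsto (fun n : ℕ => ∑' m : ℕ, z ^ m * q ^ m.choose 2 * (qPoch q q m)⁻¹ *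
      invPoch q (n + -(m : ℤ))) atTop
      (𝓝 (∑' m : ℕ, z ^ m * q ^ m.choose 2 * (qPoch q q m)⁻¹ * (qPochInf q q)⁻¹)) := by
    refine tendsto_tsum_of_dominated_convergence
      (bound := fun m => ‖z ^ m * q ^ m.choose 2 * (qPoch q q m)⁻¹‖ * C)
      (hsum2.norm.mul_right _) (fun m => (tendsto_invPoch hq _).const_mul _)
      (Eventually.of_forall fun n m => ?_)
    rw [norm_mul]
    gcongr
    exact hC _
  have h2 : ∀ n : ℕ, ∑' m : ℕ, z ^ m * q ^ m.choose 2 * (qPoch q q m)⁻¹ *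
      invPoch q (n + -(m : ℤ)) = qPoch (-z) q n * (qPoch q q n)⁻¹ := by
    intro n
    rw [← sum_qBinomial hq, tsum_eq_sum (s := Finset.range (n + 1))]
    · refine Finset.sum_congr rfl fun m hm => ?_
      have hm' : m ≤ n := by simpa [Nat.lt_succ_iff] using hm
      rw [← sub_eq_add_neg, ← Nat.cast_sub hm', invPoch_natCast, mul_assoc]
    · intro m hm
      rw [invPoch_of_neg, mul_zero]
      rw [Finset.mem_range] at hm
      omega
  have h3 := (tendsto_qPoch (-z) hq).mul ((tendsto_qPoch q hq).inv₀ hL)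
  have h4 := tendsto_nhds_unique (h1.congr h2) h3
  rw [tsum_mul_right] at h4
  rw [← mul_right_cancel₀ (inv_ne_zero hL) h4]
  exact hsum2.hasSum

section Tuples

@[to_additive sum_Icc_one_eq_sum_range]
theorem prod_Icc_one_eq_prod_range {M : Type*} [CommMonoid M] (f : ℕ → M) (k : ℕ) :
    ∏ j ∈ Finset.Icc 1 k, f j = ∏ j ∈ Finset.range k, f (j + 1) := by
  rw [← Finset.Ico_add_one_right_eq_Icc, Finset.prod_Ico_eq_prod_range, Nat.add_sub_cancel]
  simp only [add_comm]

@[to_additive sum_Icc_one_succ]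
theorem prod_Icc_one_succ {M : Type*} [CommMonoid M] (f : ℕ → M) (k : ℕ) :
    ∏ j ∈ Finset.Icc 1 (k + 1), f j = (∏ j ∈ Finset.Icc 1 k, f (j + 1)) * f 1 := by
  rw [prod_Icc_one_eq_prod_range, Finset.prod_range_succ', prod_Icc_one_eq_prod_range]

variable {k : ℕ}

theorem nahmEntry_succ (n : Fin k → ℕ) (i : Fin k) : nahmEntry n (i + 1) = n i := by
  simp [nahmEntry, i.2]

theorem nahmEntry_cons_one (a : ℕ) (x : Fin k → ℕ) :
    nahmEntry (Fin.cons a x : Fin (k + 1) → ℕ) 1 = a :=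
  nahmEntry_succ (Fin.cons a x : Fin (k + 1) → ℕ) 0

theorem nahmEntry_cons_succ (a : ℕ) (x : Fin k → ℕ) {j : ℕ} (hj : 1 ≤ j) :
    nahmEntry (Fin.cons a x : Fin (k + 1) → ℕ) (j + 1) = nahmEntry x j := by
  rcases le_or_gt j k with h | h
  · obtain ⟨j, rfl⟩ := Nat.exists_eq_add_of_le' hj
    have h1 := nahmEntry_succ x ⟨j, h⟩
    have h2 := nahmEntry_succ (Fin.cons a x : Fin (k + 1) → ℕ) (Fin.succ ⟨j, h⟩)
    rw [Fin.cons_succ] at h2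
    exact h2.trans h1.symm
  · rw [nahmEntry, nahmEntry, dif_neg (by omega), dif_neg (by omega)]

theorem nahmN_one (n : Fin k → ℕ) : nahmN n 1 = ∑ i, n i := by
  rw [nahmN, sum_Icc_one_eq_sum_range, ← Fin.sum_univ_eq_sum_range (fun j => nahmEntry n (j + 1))]
  simp only [nahmEntry_succ]

theorem nahmN_cons_succ (a : ℕ) (x : Fin k → ℕ) {j : ℕ} (hj : 1 ≤ j) :
    nahmN (Fin.cons a x : Fin (k + 1) → ℕ) (j + 1) = nahmN x j := by
  rw [nahmN, nahmN, ← Finset.map_add_right_Icc, Finset.sum_map]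
  refine Finset.sum_congr rfl fun l hl => ?_
  exact nahmEntry_cons_succ a x (hj.trans (Finset.mem_Icc.mp hl).1)

theorem sum_le_sum_nahmN_sq (n : Fin k → ℕ) :
    ∑ i, n i ≤ ∑ j ∈ Finset.Icc 1 k, nahmN n j ^ 2 := by
  rcases Nat.eq_zero_or_pos k with rfl | hk
  · simp
  · rw [← nahmN_one]
    exact (Nat.le_self_pow two_ne_zero _).trans (Finset.single_le_sum
      (f := fun j => nahmN n j ^ 2) (fun _ _ => Nat.zero_le _) (Finset.mem_Icc.mpr ⟨le_rfl, hk⟩))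

theorem sum_antidiagonalTuple_succ (N : ℕ) (f : (Fin (k + 1) → ℕ) → ℂ) :
    ∑ x ∈ Finset.Nat.antidiagonalTuple (k + 1) N, f x =
      ∑ m ∈ Finset.range (N + 1), ∑ x ∈ Finset.Nat.antidiagonalTuple k m,
        f (Fin.cons (N - m) x) := by
  rw [Finset.sum_sigma']
  refine Finset.sum_bij' (fun y _ => ⟨∑ i, Fin.tail y i, Fin.tail y⟩)
    (fun x _ => Fin.cons (N - x.1) x.2) ?_ ?_ ?_ ?_ ?_
  · intro y hy
    rw [Finset.Nat.mem_antidiagonalTuple, Fin.sum_univ_succ] at hy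
    simp only [Finset.mem_sigma, Finset.mem_range, Finset.Nat.mem_antidiagonalTuple, Fin.tail]
    exact ⟨by omega, trivial⟩
  · rintro ⟨m, x⟩ hx
    simp only [Finset.mem_sigma, Finset.mem_range, Finset.Nat.mem_antidiagonalTuple] at hx
    rw [Finset.Nat.mem_antidiagonalTuple, Fin.sum_univ_succ]
    simp only [Fin.cons_zero, Fin.cons_succ]
    omega
  · intro y hy
    rw [Finset.Nat.mem_antidiagonalTuple, Fin.sum_univ_succ] at hy
    have : N - ∑ i, Fin.tail y i = y 0 := by simp only [Fin.tail]; omega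
    simp only [this, Fin.cons_self_tail]
  · rintro ⟨m, x⟩ hx
    simp only [Finset.mem_sigma, Finset.mem_range, Finset.Nat.mem_antidiagonalTuple] at hx
    simp [hx.2]
  · intro y hy
    rw [Finset.Nat.mem_antidiagonalTuple, Fin.sum_univ_succ] at hy
    have : N - ∑ i, Fin.tail y i = y 0 := by simp only [Fin.tail]; omega
    simp only [this, Fin.cons_self_tail]

/-- The summand of a multiple sum attached to a Bailey chain with initial sequence `b`. -/
noncomputable def chainTerm (q : ℂ) (e : ℕ → ℕ) (b : ℕ → ℂ) (n : Fin (k + 1) → ℕ) : ℂ :=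
  q ^ (∑ j ∈ Finset.Icc 1 (k + 1), (nahmN n j ^ 2 + e j * nahmN n j)) *
    (∏ j ∈ Finset.Icc 1 k, qPoch q q (nahmEntry n j))⁻¹ * b (nahmEntry n (k + 1))

theorem chainTerm_cons (q : ℂ) (e : ℕ → ℕ) (b : ℕ → ℂ) (a : ℕ) (x : Fin (k + 1) → ℕ) :
    chainTerm q e b (Fin.cons a x : Fin (k + 1 + 1) → ℕ) =
      q ^ ((a + ∑ i, x i) ^ 2 + e 1 * (a + ∑ i, x i)) * (qPoch q q a)⁻¹ *
        chainTerm q (fun j => e (j + 1)) b x := by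
  have hN : nahmN (Fin.cons a x : Fin (k + 1 + 1) → ℕ) 1 = a + ∑ i, x i := by
    rw [nahmN_one, Fin.sum_univ_succ]; simp
  have h1 : ∑ j ∈ Finset.Icc 1 (k + 1),
      (nahmN (Fin.cons a x : Fin (k + 1 + 1) → ℕ) (j + 1) ^ 2 +
        e (j + 1) * nahmN (Fin.cons a x : Fin (k + 1 + 1) → ℕ) (j + 1)) =
      ∑ j ∈ Finset.Icc 1 (k + 1), (nahmN x j ^ 2 + e (j + 1) * nahmN x j) :=
    Finset.sum_congr rfl fun j hj => by rw [nahmN_cons_succ a x (Finset.mem_Icc.mp hj).1]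
  have h2 : ∏ j ∈ Finset.Icc 1 k,
      qPoch q q (nahmEntry (Fin.cons a x : Fin (k + 1 + 1) → ℕ) (j + 1)) =
      ∏ j ∈ Finset.Icc 1 k, qPoch q q (nahmEntry x j) :=
    Finset.prod_congr rfl fun j hj => by rw [nahmEntry_cons_succ a x (Finset.mem_Icc.mp hj).1]
  rw [chainTerm, chainTerm, sum_Icc_one_succ, prod_Icc_one_succ, hN, h1, h2,
    nahmEntry_cons_succ a x (Nat.le_add_left 1 k), nahmEntry_cons_one, pow_add, mul_inv]
  ring

theorem sum_chainTerm (q : ℂ) (e : ℕ → ℕ) (b : ℕ → ℂ) (N : ℕ) :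
    ∑ x ∈ Finset.Nat.antidiagonalTuple (k + 1) N, chainTerm q e b x =
      q ^ (N ^ 2 + e 1 * N) * baileyChain q b k (fun j => e (j + 2)) N := by
  induction k generalizing e N with
  | zero =>
    have h : nahmEntry ![N] 1 = N := rfl
    simp [chainTerm, baileyChain, nahmN_one, h]
  | succ k ih =>
    rw [sum_antidiagonalTuple_succ, baileyChain, baileyStep, Finset.mul_sum]
    refine Finset.sum_congr rfl fun m hm => ?_
    have hm' : m ≤ N := by simpa [Nat.lt_succ_iff] using hm
    have h : ∀ x ∈ Finset.Nat.antidiagonalTuple (k + 1) m,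
        chainTerm q e b (Fin.cons (N - m) x : Fin (k + 1 + 1) → ℕ) =
        q ^ (N ^ 2 + e 1 * N) * (qPoch q q (N - m))⁻¹ *
          chainTerm q (fun j => e (j + 1)) b x := by
      intro x hx
      rw [Finset.Nat.mem_antidiagonalTuple] at hx
      rw [chainTerm_cons, hx, Nat.sub_add_cancel hm']
    rw [Finset.sum_congr rfl h, ← Finset.mul_sum, ih]
    simp only [zero_add]
    ring

theorem baileyChain_succ_eq_sum (q : ℂ) (e : ℕ → ℕ) (b : ℕ → ℂ) (M : ℕ) :
    baileyChain q b (k + 1) (fun j => e (j + 1)) M =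
      ∑ N ∈ Finset.range (M + 1), (qPoch q q (M - N))⁻¹ *
        ∑ x ∈ Finset.Nat.antidiagonalTuple (k + 1) N, chainTerm q e b x := by
  rw [baileyChain, baileyStep]
  refine Finset.sum_congr rfl fun N _ => ?_
  rw [sum_chainTerm]
  ring

theorem summable_pow_sum {r : ℝ} (hr0 : 0 ≤ r) (hr : r < 1) (k : ℕ) :
    Summable fun n : Fin k → ℕ => r ^ ∑ i, n i := by
  induction k with
  | zero => exact (hasSum_fintype _).summable
  | succ k ih =>
    rw [← (Fin.consEquiv fun _ => ℕ).summable_iff]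
    refine ((summable_geometric_of_lt_one hr0 hr).mul_of_nonneg ih
      (fun _ => pow_nonneg hr0 _) fun _ => pow_nonneg hr0 _).congr fun x => ?_
    simp [Fin.consEquiv, Fin.sum_univ_succ, pow_add]

end Tuples

theorem summable_nahm {q s : ℂ} (hq : ‖q‖ < 1) (hs : ‖s‖ < 1) {k : ℕ}
    (E : ℕ → (Fin k → ℕ) → ℕ) (hE : ∀ m n, ∑ i, n i ≤ E m n) :
    Summable fun x : ℕ × (Fin k → ℕ) =>
      s ^ (x.1 ^ 2) * q ^ E x.1 x.2 / nahmDenom q x.1 x.2 := by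
  have hq2 : ‖q ^ 2‖ < 1 := by
    rw [norm_pow]; exact pow_lt_one₀ (norm_nonneg q) hq two_ne_zero
  obtain ⟨C, hC0, hC⟩ := exists_norm_invPoch_le hq
  obtain ⟨D, hD0, hD⟩ := exists_norm_invPoch_le hq2
  have hCn : ∀ n : ℕ, ‖(qPoch q q n)⁻¹‖ ≤ C := fun n => invPoch_natCast q n ▸ hC n
  have hDn : ∀ n : ℕ, ‖(qPoch (q ^ 2) (q ^ 2) n)⁻¹‖ ≤ D :=
    fun n => invPoch_natCast (q ^ 2) n ▸ hD n
  refine (((summable_geometric_of_lt_one (norm_nonneg s) hs).mul_of_nonneg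
    (summable_pow_sum (norm_nonneg q) hq k) (fun _ => pow_nonneg (norm_nonneg s) _)
    fun _ => pow_nonneg (norm_nonneg q) _).mul_right (C * C ^ (k - 1) * D)).of_norm_bounded ?_
  rintro ⟨m, n⟩
  rw [div_eq_mul_inv, norm_mul, norm_mul, norm_pow, norm_pow]
  have h1 : ‖s‖ ^ m ^ 2 ≤ ‖s‖ ^ m :=
    pow_le_pow_of_le_one (norm_nonneg s) hs.le (Nat.le_self_pow two_ne_zero m)
  have h2 : ‖q‖ ^ E m n ≤ ‖q‖ ^ ∑ i, n i :=
    pow_le_pow_of_le_one (norm_nonneg q) hq.le (hE m n)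
  have h3 : ‖(nahmDenom q m n)⁻¹‖ ≤ C * C ^ (k - 1) * D := by
    rw [nahmDenom, mul_inv, mul_inv, norm_mul, norm_mul, ← Finset.prod_inv_distrib, norm_prod]
    gcongr
    · exact hCn m
    · calc _ ≤ ∏ _j ∈ Finset.Icc 1 (k - 1), C :=
            Finset.prod_le_prod (fun _ _ => norm_nonneg _) fun _ _ => hCn _
        _ = _ := by simp
    · exact hDn _
  gcongr

theorem hasSum_nahm_zero {k : ℕ} (E : ℕ → (Fin k → ℕ) → ℕ) (hE : ∀ m n, ∑ i, n i ≤ E m n)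
    (hE0 : E 0 0 = 0) :
    HasSum (fun x : ℕ × (Fin k → ℕ) =>
      (0 : ℂ) ^ (x.1 ^ 2) * 0 ^ E x.1 x.2 / nahmDenom 0 x.1 x.2) 1 := by
  have h0 : ∀ j, nahmEntry (0 : Fin k → ℕ) j = 0 := by
    intro j; rw [nahmEntry]; split <;> rfl
  have h1 : (fun x : ℕ × (Fin k → ℕ) =>
      (0 : ℂ) ^ (x.1 ^ 2) * 0 ^ E x.1 x.2 / nahmDenom 0 x.1 x.2) (0, 0) = 1 := by
    simp [hE0, nahmDenom, h0, qPoch_zero]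
  rw [← h1]
  refine hasSum_single _ ?_
  rintro ⟨m, n⟩ hmn
  rcases Nat.eq_zero_or_pos m with rfl | hm
  · have hn : ∑ i, n i ≠ 0 := by
      intro h
      refine hmn (Prod.ext rfl (funext fun i => ?_))
      exact (Finset.sum_eq_zero_iff.mp h) i (Finset.mem_univ i)
    have := hE 0 n
    simp [show E 0 n ≠ 0 by omega]
  · simp [hm.ne']

theorem qPochInf_eq_qPoch_mul (a : ℂ) {q : ℂ} (hq : ‖q‖ < 1) (c : ℕ) :
    qPochInf a q = qPoch a q c * qPochInf (a * q ^ c) q := by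
  have h1 := (tendsto_qPoch (a * q ^ c) hq).const_mul (qPoch a q c)
  have h2 := (tendsto_add_atTop_iff_nat c).mpr (tendsto_qPoch a hq)
  refine tendsto_nhds_unique h2 (h1.congr fun n => ?_)
  rw [add_comm n c, qPoch, qPoch, qPoch, Finset.prod_range_add]
  simp only [pow_add, mul_assoc]

/-- Evaluation of the multiple sum from the limit of the Bailey chain. -/
theorem hasSum_nahm {q s : ℂ} (hq : ‖q‖ < 1) (hsq : s ^ 2 = q) {k d : ℕ} (e : ℕ → ℕ)
    (b : ℕ → ℂ) {K Θ : ℂ}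
    (hb : ∀ c, qPochInf (-(s * q ^ (c + d))) q * (qPoch (q ^ 2) (q ^ 2) c)⁻¹ = K * b c)
    (E : ℕ → (Fin (k + 1) → ℕ) → ℕ)
    (hE : ∀ m n, E m n = m * nahmEntry n (k + 1) +
      ∑ j ∈ Finset.Icc 1 (k + 1), (nahmN n j ^ 2 + e j * nahmN n j) + d * m)
    (hlim : Tendsto (baileyChain q b (k + 1) fun j => e (j + 1)) atTop
      (𝓝 (Θ / qPochInf q q ^ 2))) :
    HasSum (fun x : ℕ × (Fin (k + 1) → ℕ) =>
      s ^ (x.1 ^ 2) * q ^ E x.1 x.2 / nahmDenom q x.1 x.2) (K * Θ / qPochInf q q) := by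
  have hs : ‖s‖ < 1 := by
    rw [← hsq, norm_pow] at hq
    exact (pow_lt_one_iff_of_nonneg (norm_nonneg s) two_ne_zero).mp hq
  have hL := qPochInf_self_ne_zero hq
  have hsum := summable_nahm (q := q) (s := s) hq hs E fun m n => by
    have h1 := sum_le_sum_nahmN_sq n
    rw [hE, Finset.sum_add_distrib]
    omega
  have hinner : ∀ n : Fin (k + 1) → ℕ, HasSum (fun m : ℕ =>
      s ^ (m ^ 2) * q ^ E m n / nahmDenom q m n) (K * chainTerm q e b n) := by
    intro n
    have h := (hasSum_euler hq (s * q ^ (nahmEntry n (k + 1) + d))).mul_right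
      (q ^ (∑ j ∈ Finset.Icc 1 (k + 1), (nahmN n j ^ 2 + e j * nahmN n j)) *
        (∏ j ∈ Finset.Icc 1 k, qPoch q q (nahmEntry n j))⁻¹ *
        (qPoch (q ^ 2) (q ^ 2) (nahmEntry n (k + 1)))⁻¹)
    have hval : qPochInf (-(s * q ^ (nahmEntry n (k + 1) + d))) q *
        (q ^ (∑ j ∈ Finset.Icc 1 (k + 1), (nahmN n j ^ 2 + e j * nahmN n j)) *
        (∏ j ∈ Finset.Icc 1 k, qPoch q q (nahmEntry n j))⁻¹ *
        (qPoch (q ^ 2) (q ^ 2) (nahmEntry n (k + 1)))⁻¹) = K * chainTerm q e b n := by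
      rw [chainTerm, mul_left_comm K, ← hb]
      ring
    rw [hval] at h
    refine Eq.mpr (congrArg (fun f => HasSum f _) (funext fun m => ?_)) h
    have hm : s ^ (m ^ 2) = s ^ m * q ^ m.choose 2 := by
      rw [← hsq, ← pow_mul, ← pow_add]
      congr 1
      induction m with
      | zero => rfl
      | succ m ih =>
        rw [Nat.choose_succ_succ' m 1, Nat.choose_one_right]
        linarith
    rw [hm, hE, nahmDenom, Nat.add_sub_cancel, div_eq_mul_inv, mul_inv, mul_inv]
    ring
  have htot := (Prod.swap_injective.hasSum_iff (f := fun x : ℕ × (Fin (k + 1) → ℕ) =>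
      s ^ (x.1 ^ 2) * q ^ E x.1 x.2 / nahmDenom q x.1 x.2)
      (fun x hx => absurd ⟨x.swap, Prod.swap_swap x⟩ hx)).mpr hsum.hasSum
  have hn := htot.prod_fiberwise hinner
  have hN := ((Finset.Nat.sigmaAntidiagonalTupleEquivTuple (k + 1)).hasSum_iff.mpr hn).sigma
    fun N => hasSum_fintype _
  change HasSum (fun N => ∑ x : Finset.Nat.antidiagonalTuple (k + 1) N,
    K * chainTerm q e b (x : Fin (k + 1) → ℕ)) _ at hN
  obtain ⟨C, hC0, hC⟩ := exists_norm_invPoch_le hq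
  have hlim2 : Tendsto (fun M : ℕ => ∑' N : ℕ, invPoch q (M + -(N : ℤ)) *
      ∑ x : Finset.Nat.antidiagonalTuple (k + 1) N, K * chainTerm q e b (x : Fin (k + 1) → ℕ)) atTop
      (𝓝 (∑' N : ℕ, (qPochInf q q)⁻¹ *
        ∑ x : Finset.Nat.antidiagonalTuple (k + 1) N, K * chainTerm q e b (x : Fin (k + 1) → ℕ))) := by
    refine tendsto_tsum_of_dominated_convergence (hN.summable.norm.mul_left C)
      (fun N => (tendsto_invPoch hq _).mul_const _) (Eventually.of_forall fun M N => ?_)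
    rw [norm_mul]
    gcongr
    exact hC _
  have hval : ∀ M : ℕ, ∑' N : ℕ, invPoch q (M + -(N : ℤ)) *
      ∑ x : Finset.Nat.antidiagonalTuple (k + 1) N, K * chainTerm q e b (x : Fin (k + 1) → ℕ) =
      K * baileyChain q b (k + 1) (fun j => e (j + 1)) M := by
    intro M
    rw [baileyChain_succ_eq_sum, tsum_eq_sum (s := Finset.range (M + 1)), Finset.mul_sum]
    · refine Finset.sum_congr rfl fun N hN => ?_
      have hN' : N ≤ M := by simpa [Nat.lt_succ_iff] using hN
      rw [Finset.sum_coe_sort _ fun x => K * chainTerm q e b x, ← Finset.mul_sum,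
        ← sub_eq_add_neg, ← Nat.cast_sub hN', invPoch_natCast]
      ring
    · intro N hN
      rw [invPoch_of_neg, zero_mul]
      rw [Finset.mem_range] at hN
      omega
  have hfin := tendsto_nhds_unique (hlim2.congr hval) (hlim.const_mul K)
  rw [tsum_mul_left, hN.tsum_eq] at hfin
  have : K * Θ / qPochInf q q = ∑' x : ℕ × (Fin (k + 1) → ℕ),
      s ^ (x.1 ^ 2) * q ^ E x.1 x.2 / nahmDenom q x.1 x.2 := by
    field_simp at hfin ⊢
    linear_combination -hfin
  rw [this]
  exact hsum.hasSum

section Evaluation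

variable {q s : ℂ} (hq : ‖q‖ < 1) (hsq : s ^ 2 = q)
include hq hsq

theorem qPochInf_neg_mul_inv (c d : ℕ) :
    qPochInf (-(s * q ^ (c + d))) q * (qPoch (q ^ 2) (q ^ 2) c)⁻¹ =
      qPochInf (-s) q * (qPoch (q ^ 2) (q ^ 2) c * qPoch (-s) q (c + d))⁻¹ := by
  have h := qPoch_neg_ne_zero hq hsq (c + d)
  rw [qPochInf_eq_qPoch_mul (-s) hq (c + d), neg_mul, mul_inv]
  field_simp

theorem norm_lt_one_of_sq_eq : ‖s‖ < 1 := by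
  rw [← hsq, norm_pow] at hq
  exact (pow_lt_one_iff_of_nonneg (norm_nonneg s) two_ne_zero).mp hq

theorem tendsto_baileySum_thetaCoeff (hs : s ≠ 0) (e a b c : ℕ) (ha : a ≠ 0) (hbc : b + c = a) :
    Tendsto (baileySum q e (thetaCoeff s a b)) atTop
      (𝓝 (qPochInf₃ (s ^ c) (s ^ b) (s ^ a) (s ^ a) / qPochInf q q ^ 2)) := by
  have hs1 := norm_lt_one_of_sq_eq hq hsq
  have h := tendsto_baileySum hq e (summable_thetaCoeff hs hs1 ha b)
  rw [tsum_thetaCoeff hs hs1 ha, zpow_natCast, show (a : ℤ) - b = c by omega, zpow_natCast] at h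
  rwa [qPochInf₃, mul_comm (qPochInf (s ^ c) (s ^ a)), ← qPochInf₃]

end Evaluation

theorem qPochInf_zero_zero : qPochInf 0 0 = 1 := by simp [qPochInf]

theorem sum_Icc_eq_sum_ite (f : ℕ → ℕ) {i : ℕ} (hi : 1 ≤ i) (k : ℕ) :
    ∑ j ∈ Finset.Icc i k, f j = ∑ j ∈ Finset.Icc 1 k, (if i ≤ j then 1 else 0) * f j := by
  simp only [ite_mul, one_mul, zero_mul]
  rw [← Finset.sum_filter]
  congr 1
  ext j
  simp only [Finset.mem_Icc, Finset.mem_filter]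
  omega

theorem nahmN_zero {k : ℕ} (j : ℕ) : nahmN (0 : Fin k → ℕ) j = 0 := by
  refine Finset.sum_eq_zero fun l _ => ?_
  rw [nahmEntry]; split <;> rfl

theorem hasSum_nahm_linear {q s : ℂ} (hq : ‖q‖ < 1) (hsq : s ^ 2 = q) {k : ℕ} (hk : 1 ≤ k)
    {i : ℕ} (hi : 1 ≤ i) (hik : i ≤ k + 1) :
    HasSum (fun x : ℕ × (Fin k → ℕ) =>
      s ^ (x.1 ^ 2) *
        q ^ (x.1 * nahmEntry x.2 k + ∑ j ∈ Finset.Icc 1 k, nahmN x.2 j ^ 2 +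
          ∑ j ∈ Finset.Icc i k, nahmN x.2 j) / nahmDenom q x.1 x.2)
      (qPochInf (-s) q *
        qPochInf₃ (q ^ i) (s ^ (3 + 4 * k - 2 * i)) (s ^ (3 + 4 * k)) (s ^ (3 + 4 * k)) /
        qPochInf q q) := by
  obtain ⟨k, rfl⟩ := Nat.exists_eq_add_of_le' hk
  rcases eq_or_ne s 0 with rfl | hs
  · obtain rfl : q = 0 := by simpa using hsq.symm
    have h := hasSum_nahm_zero (k := k + 1) (fun m n => m * nahmEntry n (k + 1) +
      ∑ j ∈ Finset.Icc 1 (k + 1), nahmN n j ^ 2 + ∑ j ∈ Finset.Icc i (k + 1), nahmN n j)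
      (fun m n => (sum_le_sum_nahmN_sq n).trans (by omega)) (by simp [nahmN_zero])
    have h1 : i ≠ 0 := by omega
    have h2 : 3 + 4 * (k + 1) - 2 * i ≠ 0 := by omega
    have h3 : 3 + 4 * (k + 1) ≠ 0 := by omega
    simpa [qPochInf₃, qPochInf_zero_zero, h1, h2, h3] using h
  · refine hasSum_nahm (d := 0) hq hsq (fun j => if i ≤ j then 1 else 0)
      (fun c => (qPoch (q ^ 2) (q ^ 2) c * qPoch (-s) q c)⁻¹)
      (fun c => qPochInf_neg_mul_inv hq hsq c 0)
      (fun m n => m * nahmEntry n (k + 1) +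
        ∑ j ∈ Finset.Icc 1 (k + 1), nahmN n j ^ 2 + ∑ j ∈ Finset.Icc i (k + 1), nahmN n j)
      (fun m n => ?_) ?_
    · rw [sum_Icc_eq_sum_ite _ hi, Finset.sum_add_distrib]
      ring
    · have hb : (fun c => (qPoch (q ^ 2) (q ^ 2) c * qPoch (-s) q c)⁻¹) =
          baileySum q 0 (thetaCoeff s 3 1) :=
        funext fun c => (baileySum_one_thetaCoeff_eq hq hs hsq c).2.symm
      rw [hb, baileyChain_ite hq hs hsq (k + 1) i hi hik]
      have h := tendsto_baileySum_thetaCoeff hq hsq hs 0 (3 + 4 * (k + 1))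
        (3 + 4 * (k + 1) - 2 * i) (2 * i) (by omega) (by omega)
      rw [pow_mul, hsq] at h
      have e1 : ((3 + 4 * (k + 1) : ℕ) : ℤ) = 4 * ((k + 1 : ℕ) : ℤ) + 3 := by push_cast; ring
      have e2 : ((3 + 4 * (k + 1) - 2 * i : ℕ) : ℤ) = 4 * ((k + 1 : ℕ) : ℤ) + 3 - 2 * i := by
        omega
      rwa [e1, e2] at h

theorem hasSum_nahm_linear_shift {q s : ℂ} (hq : ‖q‖ < 1) (hsq : s ^ 2 = q) {k : ℕ}
    (hk : 1 ≤ k) :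
    HasSum (fun x : ℕ × (Fin k → ℕ) =>
      s ^ (x.1 ^ 2) *
        q ^ (x.1 * nahmEntry x.2 k + ∑ j ∈ Finset.Icc 1 k, nahmN x.2 j ^ 2 +
          x.1 + ∑ j ∈ Finset.Icc 1 k, nahmN x.2 j) / nahmDenom q x.1 x.2)
      (qPochInf (-s) q *
        qPochInf₃ s (q ^ (1 + 2 * k)) (s ^ (3 + 4 * k)) (s ^ (3 + 4 * k)) / qPochInf q q) := by
  obtain ⟨k, rfl⟩ := Nat.exists_eq_add_of_le' hk
  rcases eq_or_ne s 0 with rfl | hs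
  · obtain rfl : q = 0 := by simpa using hsq.symm
    have h := hasSum_nahm_zero (k := k + 1) (fun m n => m * nahmEntry n (k + 1) +
      ∑ j ∈ Finset.Icc 1 (k + 1), nahmN n j ^ 2 + m + ∑ j ∈ Finset.Icc 1 (k + 1), nahmN n j)
      (fun m n => (sum_le_sum_nahmN_sq n).trans (by omega)) (by simp [nahmN_zero])
    have h2 : 1 + 2 * (k + 1) ≠ 0 := by omega
    have h3 : 3 + 4 * (k + 1) ≠ 0 := by omega
    simpa [qPochInf₃, qPochInf_zero_zero, h2, h3] using h
  · refine hasSum_nahm (d := 1) hq hsq (fun _ => 1)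
      (fun c => (qPoch (q ^ 2) (q ^ 2) c * qPoch (-s) q (c + 1))⁻¹)
      (fun c => qPochInf_neg_mul_inv hq hsq c 1)
      (fun m n => m * nahmEntry n (k + 1) +
        ∑ j ∈ Finset.Icc 1 (k + 1), nahmN n j ^ 2 + m + ∑ j ∈ Finset.Icc 1 (k + 1), nahmN n j)
      (fun m n => ?_) ?_
    · simp only [one_mul]
      rw [Finset.sum_add_distrib]
      ring
    · have hb : (fun c => (qPoch (q ^ 2) (q ^ 2) c * qPoch (-s) q (c + 1))⁻¹) =
          baileySum q 1 (thetaCoeff s 3 2) :=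
        funext fun c => (baileySum_one_thetaCoeff_eq hq hs hsq c).1.symm
      rw [hb, baileyChain_one hq hs hsq]
      have h := tendsto_baileySum_thetaCoeff hq hsq hs 1 (3 + 4 * (k + 1))
        (2 * (1 + 2 * (k + 1))) 1 (by omega) (by omega)
      rw [pow_mul, hsq, pow_one] at h
      have e1 : ((3 + 4 * (k + 1) : ℕ) : ℤ) = 4 * ((k + 1 : ℕ) : ℤ) + 3 := by push_cast; ring
      have e2 : ((2 * (1 + 2 * (k + 1)) : ℕ) : ℤ) = 4 * ((k + 1 : ℕ) : ℤ) + 2 := by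
        push_cast; ring
      rwa [e1, e2] at h

theorem qPochInf_mul_neg {q : ℂ} (hq : ‖q‖ < 1) (a : ℂ) :
    qPochInf a q * qPochInf (-a) q = qPochInf (a ^ 2) (q ^ 2) := by
  refine ((hasProd_qPochInf a q hq).mul (hasProd_qPochInf (-a) q hq)).unique ?_
  have hq2 : ‖q ^ 2‖ < 1 := by
    rw [norm_pow]; exact pow_lt_one₀ (norm_nonneg q) hq two_ne_zero
  convert hasProd_qPochInf (a ^ 2) (q ^ 2) hq2 using 2 with j
  ring

theorem qPochInf_sq_mul {q : ℂ} (hq : ‖q‖ < 1) (a : ℂ) :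
    qPochInf a (q ^ 2) * qPochInf (a * q) (q ^ 2) = qPochInf a q := by
  have hq2 : ‖q ^ 2‖ < 1 := by
    rw [norm_pow]; exact pow_lt_one₀ (norm_nonneg q) hq two_ne_zero
  refine (HasProd.even_mul_odd ?_ ?_).unique (hasProd_qPochInf a q hq)
  · simpa only [pow_mul] using hasProd_qPochInf a (q ^ 2) hq2
  · simpa only [pow_succ', pow_mul, mul_assoc] using hasProd_qPochInf (a * q) (q ^ 2) hq2

theorem qPochInf_neg_mul_div {q : ℂ} (hq : ‖q‖ < 1) (x : ℂ) :
    qPochInf (-q) (q ^ 2) * x / qPochInf (q ^ 2) (q ^ 2) =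
      x / (qPochInf q (q ^ 2) * qPochInf (q ^ 4) (q ^ 4)) := by
  have hpow : ∀ m : ℕ, m ≠ 0 → ‖q ^ m‖ < 1 := fun m hm => by
    rw [norm_pow]; exact pow_lt_one₀ (norm_nonneg q) hq hm
  have h1 := qPochInf_mul_neg (hpow 2 two_ne_zero) q
  have h2 := qPochInf_sq_mul (hpow 2 two_ne_zero) (q ^ 2)
  rw [← sq, ← pow_mul] at h2
  rw [← pow_mul] at h1
  norm_num at h1 h2
  have n1 := qPochInf_self_ne_zero (hpow 2 two_ne_zero)
  have n2 := qPochInf_self_ne_zero (hpow 4 four_ne_zero)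
  have n3 : qPochInf q (q ^ 2) ≠ 0 := qPochInf_ne_zero (hpow 2 two_ne_zero) fun j => by
    rw [← pow_mul, ← pow_succ']
    exact one_sub_pow_succ_ne_zero hq _
  rw [div_eq_div_iff n1 (mul_ne_zero n3 n2), ← h2, ← h1]
  ring

section Triple

variable (n : Fin 2 → ℕ)

theorem nahmEntry_fin_two : nahmEntry n 1 = n 0 ∧ nahmEntry n 2 = n 1 :=
  ⟨nahmEntry_succ n 0, nahmEntry_succ n 1⟩

theorem nahmN_fin_two : nahmN n 1 = n 0 + n 1 ∧ nahmN n 2 = n 1 := by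
  refine ⟨by rw [nahmN_one, Fin.sum_univ_two], ?_⟩
  rw [nahmN, Finset.Icc_self, Finset.sum_singleton, (nahmEntry_fin_two n).2]

theorem nahmDenom_fin_two (q : ℂ) (m : ℕ) :
    nahmDenom (q ^ 2) m n = tripleDenom q m (n 0) (n 1) := by
  have h := nahmEntry_fin_two n
  rw [nahmDenom, tripleDenom, ← pow_mul, Finset.Icc_self, Finset.prod_singleton, h.1, h.2]

end Triple

theorem hasSum_triple {q x z : ℂ} (hq : ‖q‖ < 1) (D : ℕ → ℕ → ℕ → ℕ) (E : ℕ → (Fin 2 → ℕ) → ℕ)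
    (h : HasSum (fun x : ℕ × (Fin 2 → ℕ) =>
      q ^ (x.1 ^ 2) * (q ^ 2) ^ E x.1 x.2 / nahmDenom (q ^ 2) x.1 x.2)
      (qPochInf (-q) (q ^ 2) * z / qPochInf (q ^ 2) (q ^ 2)))
    (hzx : z = x) (hDE : ∀ m n, D m (n 0) (n 1) = m ^ 2 + 2 * E m n) :
    HasSum (fun y : ℕ × ℕ × ℕ => q ^ D y.1 y.2.1 y.2.2 / tripleDenom q y.1 y.2.1 y.2.2)
      (x / (qPochInf q (q ^ 2) * qPochInf (q ^ 4) (q ^ 4))) := by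
  subst hzx
  rw [← ((Equiv.refl ℕ).prodCongr (finTwoArrowEquiv ℕ)).hasSum_iff, ← qPochInf_neg_mul_div hq]
  refine Eq.mpr (congrArg (fun f => HasSum f _) (funext fun y => ?_)) h
  rw [nahmDenom_fin_two, ← pow_mul, ← pow_add, ← hDE]
  rfl

end Analysis

theorem mainTheorem4 :
    -- the four triple sums of index `(1, 1, 2)`
    (∀ q : ℂ, ‖q‖ < 1 →
      HasSum (fun ((i, j, k) : ℕ × ℕ × ℕ) =>
          q ^ (i ^ 2 + 2 * j ^ 2 + 4 * k ^ 2 + 2 * i * k + 4 * j * k) / tripleDenom q i j k)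
        (qPochInf₃ (q ^ 5) (q ^ 6) (q ^ 11) (q ^ 11) /
          (qPochInf q (q ^ 2) * qPochInf (q ^ 4) (q ^ 4))) ∧
      HasSum (fun ((i, j, k) : ℕ × ℕ × ℕ) =>
          q ^ (i ^ 2 + 2 * j ^ 2 + 4 * k ^ 2 + 2 * i * k + 4 * j * k + 2 * k) /
            tripleDenom q i j k)
        (qPochInf₃ (q ^ 4) (q ^ 7) (q ^ 11) (q ^ 11) /
          (qPochInf q (q ^ 2) * qPochInf (q ^ 4) (q ^ 4))) ∧
      HasSum (fun ((i, j, k) : ℕ × ℕ × ℕ) =>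
          q ^ (i ^ 2 + 2 * j ^ 2 + 4 * k ^ 2 + 2 * i * k + 4 * j * k + 2 * j + 4 * k) /
            tripleDenom q i j k)
        (qPochInf₃ (q ^ 2) (q ^ 9) (q ^ 11) (q ^ 11) /
          (qPochInf q (q ^ 2) * qPochInf (q ^ 4) (q ^ 4))) ∧
      HasSum (fun ((i, j, k) : ℕ × ℕ × ℕ) =>
          q ^ (i ^ 2 + 2 * j ^ 2 + 4 * k ^ 2 + 2 * i * k + 4 * j * k + 2 * i + 2 * j + 4 * k) /
            tripleDenom q i j k)
        (qPochInf₃ q (q ^ 10) (q ^ 11) (q ^ 11) /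
          (qPochInf q (q ^ 2) * qPochInf (q ^ 4) (q ^ 4)))) ∧
    -- the `(k + 1)`-fold generalization of the first three; `s` is `q ^ (1 / 2)`
    (∀ q s : ℂ, ‖q‖ < 1 → s ^ 2 = q → ∀ k : ℕ, 1 ≤ k → ∀ i : ℕ, 1 ≤ i → i ≤ k + 1 →
      HasSum (fun ((m, n) : ℕ × (Fin k → ℕ)) =>
          s ^ (m ^ 2) *
            q ^ (m * nahmEntry n k + ∑ j ∈ Finset.Icc 1 k, nahmN n j ^ 2 +
              ∑ j ∈ Finset.Icc i k, nahmN n j) / nahmDenom q m n)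
        (qPochInf (-s) q *
          qPochInf₃ (q ^ i) (s ^ (3 + 4 * k - 2 * i)) (s ^ (3 + 4 * k)) (s ^ (3 + 4 * k)) /
          qPochInf q q)) ∧
    -- the `(k + 1)`-fold generalization of the last one; `s` is `q ^ (1 / 2)`
    (∀ q s : ℂ, ‖q‖ < 1 → s ^ 2 = q → ∀ k : ℕ, 1 ≤ k →
      HasSum (fun ((m, n) : ℕ × (Fin k → ℕ)) =>
          s ^ (m ^ 2) *
            q ^ (m * nahmEntry n k + ∑ j ∈ Finset.Icc 1 k, nahmN n j ^ 2 +
              m + ∑ j ∈ Finset.Icc 1 k, nahmN n j) / nahmDenom q m n)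
        (qPochInf (-s) q *
          qPochInf₃ s (q ^ (1 + 2 * k)) (s ^ (3 + 4 * k)) (s ^ (3 + 4 * k)) /
          qPochInf q q)) := by
  refine ⟨fun q hq => ?_, fun q s hq hsq k hk i hi hik => hasSum_nahm_linear hq hsq hk hi hik,
    fun q s hq hsq k hk => hasSum_nahm_linear_shift hq hsq hk⟩
  have hq2 : ‖q ^ 2‖ < 1 := by
    rw [norm_pow]; exact pow_lt_one₀ (norm_nonneg q) hq two_ne_zero
  have i1 := hasSum_nahm_linear (s := q) hq2 rfl one_le_two (i := 3) (by norm_num) (by norm_num)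
  have i2 := hasSum_nahm_linear (s := q) hq2 rfl one_le_two (i := 2) (by norm_num) (by norm_num)
  have i3 := hasSum_nahm_linear (s := q) hq2 rfl one_le_two (i := 1) (by norm_num) (by norm_num)
  have i4 := hasSum_nahm_linear_shift (s := q) hq2 rfl one_le_two
  have hexp : ∀ n : Fin 2 → ℕ, ∑ j ∈ Finset.Icc 1 2, nahmN n j ^ 2 =
      (n 0 + n 1) ^ 2 + n 1 ^ 2 := fun n => by
    rw [sum_Icc_one_eq_sum_range, Finset.sum_range_succ, Finset.sum_range_one,
      (nahmN_fin_two n).1, (nahmN_fin_two n).2]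
  have hlin : ∀ n : Fin 2 → ℕ, ∑ j ∈ Finset.Icc 1 2, nahmN n j = n 0 + n 1 + n 1 := fun n => by
    rw [sum_Icc_one_eq_sum_range, Finset.sum_range_succ, Finset.sum_range_one,
      (nahmN_fin_two n).1, (nahmN_fin_two n).2]
  have hone : ∀ n : Fin 2 → ℕ, ∑ j ∈ Finset.Icc 2 2, nahmN n j = n 1 := fun n => by
    rw [Finset.Icc_self, Finset.sum_singleton, (nahmN_fin_two n).2]
  have hent : ∀ n : Fin 2 → ℕ, nahmEntry n 2 = n 1 := fun n => (nahmEntry_fin_two n).2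
  have e1 : qPochInf₃ ((q ^ 2) ^ 3) (q ^ (3 + 4 * 2 - 2 * 3)) (q ^ (3 + 4 * 2)) (q ^ (3 + 4 * 2)) =
      qPochInf₃ (q ^ 5) (q ^ 6) (q ^ 11) (q ^ 11) := by
    rw [← pow_mul, qPochInf₃, mul_comm (qPochInf (q ^ (2 * 3)) _), ← qPochInf₃]
  have e2 : qPochInf₃ ((q ^ 2) ^ 2) (q ^ (3 + 4 * 2 - 2 * 2)) (q ^ (3 + 4 * 2)) (q ^ (3 + 4 * 2)) =
      qPochInf₃ (q ^ 4) (q ^ 7) (q ^ 11) (q ^ 11) := by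
    rw [← pow_mul]
  have e3 : qPochInf₃ ((q ^ 2) ^ 1) (q ^ (3 + 4 * 2 - 2 * 1)) (q ^ (3 + 4 * 2)) (q ^ (3 + 4 * 2)) =
      qPochInf₃ (q ^ 2) (q ^ 9) (q ^ 11) (q ^ 11) := by
    rw [← pow_mul]
  have e4 : qPochInf₃ q ((q ^ 2) ^ (1 + 2 * 2)) (q ^ (3 + 4 * 2)) (q ^ (3 + 4 * 2)) =
      qPochInf₃ q (q ^ 10) (q ^ 11) (q ^ 11) := by
    rw [← pow_mul]
  refine ⟨hasSum_triple hq
      (fun i j k => i ^ 2 + 2 * j ^ 2 + 4 * k ^ 2 + 2 * i * k + 4 * j * k)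
      (fun m n => m * nahmEntry n 2 + ∑ j ∈ Finset.Icc 1 2, nahmN n j ^ 2 +
        ∑ j ∈ Finset.Icc 3 2, nahmN n j) i1 e1 fun m n => ?_,
    hasSum_triple hq
      (fun i j k => i ^ 2 + 2 * j ^ 2 + 4 * k ^ 2 + 2 * i * k + 4 * j * k + 2 * k)
      (fun m n => m * nahmEntry n 2 + ∑ j ∈ Finset.Icc 1 2, nahmN n j ^ 2 +
        ∑ j ∈ Finset.Icc 2 2, nahmN n j) i2 e2 fun m n => ?_,
    hasSum_triple hq
      (fun i j k => i ^ 2 + 2 * j ^ 2 + 4 * k ^ 2 + 2 * i * k + 4 * j * k + 2 * j + 4 * k)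
      (fun m n => m * nahmEntry n 2 + ∑ j ∈ Finset.Icc 1 2, nahmN n j ^ 2 +
        ∑ j ∈ Finset.Icc 1 2, nahmN n j) i3 e3 fun m n => ?_,
    hasSum_triple hq
      (fun i j k => i ^ 2 + 2 * j ^ 2 + 4 * k ^ 2 + 2 * i * k + 4 * j * k + 2 * i + 2 * j + 4 * k)
      (fun m n => m * nahmEntry n 2 + ∑ j ∈ Finset.Icc 1 2, nahmN n j ^ 2 +
        m + ∑ j ∈ Finset.Icc 1 2, nahmN n j) i4 e4 fun m n => ?_⟩
  · rw [hexp, hent, Finset.Icc_eq_empty (by norm_num), Finset.sum_empty]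
    ring
  · rw [hexp, hent, hone]
    ring
  · rw [hexp, hent, hlin]
    ring
  · rw [hexp, hent, hlin]
    ring
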